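/- A \emph{Schröder path} of semilength $n$ is a lattice path from $(0,0)$ to $(2n,0)$ with steps $\mathsf u=(1,1)$, $\mathsf d=(1,-1)$, $\mathsf e=(2,0)$ that never goes below the $x$-axis. Let $r_0=1$, $r_n=r_{n-1}+\sum_{k=1}^{n}r_{k-1}r_{n-k}$ be the large Schröder numbers and $B(i)=r_0+\dots+r_{i-2}$ (so $B(1)=0$). For a list $L$ let $L(j)$ be its $j$-th entry, and let $L^i$ be $L$ if $i$ is odd and $L$ reversed if $i$ is even. Define lists $\mathcal S_n$ of paths recursively: $\mathcal S_0$ consists of the empty path, and for $n\ge 1$, with $\bigoplus$ denoting concatenation of lists, $$\mathcal S_n=\bigoplus_{i=1}^{r_{n-1}}\bigl(\mathsf e\,\mathcal S_{n-1}(i)\bigr)\ \oplus\ \bigoplus_{i=1}^{n}\bigoplus_{j=1}^{r_{i-1}}\bigoplus_{k=1}^{r_{n-i}}\Bigl(\mathsf u\,\mathcal S_{i-1}^{\,n+i}(j)\,\mathsf d\,\mathcal S_{n-i}^{\,j+B(i)+1}(k)\Bigr).$$ For a Schröder path $p$ of semilength $n$ define $\varphi(p)\in\mathfrak S_{n+1}$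 as follows (Egge and Mansour). Place a dot at each of the points $(\frac{8m+1}{4},\frac{8a+5}{4})$ and $(\frac{8m+5}{4},\frac{8a+1}{4})$, $0\le a,m<n$, that lies beneath $p$ and above the $x$-axis, and label the dot at $(x,y)$ by $s_i$, where $i=(1+x-y)/2$. As long as some dot has no line through it, take the rightmost such dot (it is unique), with label $s_k$, say, and draw a line from it, to the left and parallel to the $x$-axis, to the leftmost dot that can be reached without crossing $p$, with label $s_l$, say; the $j$-th line drawn gives $\sigma_j=s_ks_{k-1}\cdots s_l$. If $t$ lines are drawn in all, put $\varphi(p)=\sigma_t\cdots\sigma_2\sigma_1(n+1,n,\dots,1)$, where $s_i$ applied to a permutation exchanges its entries in positions $i$ and $i+1$, and products are applied from right to left. Let $\Phi_n=(\varphi(\mathcal S_n(1)),\varphi(\mathcal S_n(2)),\dots)$. The distance $d$ of two permutations is the number of positions in which they differ; the distance $d$ of two paths is the number of positions in which their words differ after each $\mathsf e$ is replaced by $\mathsf r\mathsf r$. Then, for every $n\ge 0$: the list $\mathcal S_n$ has length $r_n$ and contains every Schröder path of semilength $n$ exactly once, and nothing else; $\varphi$ is a bijection from the set of Schröder paths of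 semilength $n$ onto the set $\mathfrak S_{n+1}(1243,2143)$ of permutations of length $n+1$ that avoid the patterns $1243$ and $2143$; the list $\Phi_n$ contains every element of $\mathfrak S_{n+1}(1243,2143)$ exactly once, and nothing else; and for each $1\le q<r_n$, $$d(\mathcal S_n(q),\mathcal S_n(q+1))\le 5\quad\text{and}\quad d(\Phi_n(q),\Phi_n(q+1))\le 5 .$$ Thus $\mathcal S_n$ and $\Phi_n$ are Gray codes with distance $5$ for Schröder paths and Schröder permutations. -/

import Mathlib

namespace SchroderGray

/-! ### Schröder paths -/

/-- The steps `u = (1,1)`, `d = (1,-1)` and `e = (2,0)`. -/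
inductive Step where
  | u
  | d
  | e
  deriving DecidableEq

/-- Horizontal displacement of a step. -/
def Step.width : Step → ℕ
  | .u => 1
  | .d => 1
  | .e => 2

/-- Vertical displacement of a step. -/
def Step.rise : Step → ℤ
  | .u => 1
  | .d => -1
  | .e => 0

/-- A lattice path starting at the origin, given as its word of steps. -/
abbrev Path := List Step

/-- `p` is a Schröder path from `(0,0)` to `(2n,0)`: it never goes below the `x`-axis. -/
def IsSchroderPath (n : ℕ) (p : Path) : Prop :=
  (p.map Step.width).sum = 2 * n ∧
  (p.map Step.rise).sum = 0 ∧
  ∀ q : Path, q <+: p → 0 ≤ (q.map Step.rise).sum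

/-- The alphabet of the words obtained by replacing each `e` by `rr`. -/
inductive UnitStep where
  | u
  | d
  | r
  deriving DecidableEq

/-- A step as a word of steps of width one; `e` becomes `rr`. -/
def Step.expand : Step → List UnitStep
  | .u => [.u]
  | .d => [.d]
  | .e => [.r, .r]

/-- The number of places in which two words differ. -/
def wordDist {α : Type*} [DecidableEq α] (v w : List α) : ℕ :=
  ((Finset.range (max v.length w.length)).filter (fun i => v[i]? ≠ w[i]?)).card

/-- The number of places in which two paths differ when each `e` is replaced by `rr`. -/
def pathDist (p q : Path) : ℕ :=
  wordDist (p.flatMap Step.expand) (q.flatMap Step.expand)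

/-! ### The list of Schröder paths -/

/-- `B(i) = r₀ + ⋯ + r_{i-2}` with `r` the large Schröder numbers; `B(1) = 0`. -/
def B (i : ℕ) : ℕ := ∑ k ∈ Finset.range (i - 1), Nat.largeSchroder k

/-- `L` if `i` is odd, and `L` reversed if `i` is even. -/
def orient {α : Type*} (i : ℕ) (L : List α) : List α :=
  if Odd i then L else L.reverse

/-- The recursively generated list `𝒮ₙ`. In the case `n + 1`, the index `i'` runs through
`0, …, n` and `i = i' + 1`; `zipIdx 1` pairs the entries of a list with the positions
`j = 1, 2, …`. The entries are
`e 𝒮ₙ(k)` for all `k`, followed by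
`u 𝒮_{i-1}^{(n+1)+i}(j) d 𝒮_{(n+1)-i}^{j+B(i)+1}(k)` for all `i`, `j`, `k` in lexicographic
order. -/
def pathList : ℕ → List Path
  | 0 => [[]]
  | n + 1 =>
    (pathList n).map (fun p => Step.e :: p) ++
    (List.finRange (n + 1)).flatMap (fun i' =>
      ((orient ((n + 1) + (i'.val + 1)) (pathList i'.val)).zipIdx 1).flatMap (fun aj =>
        (orient (aj.2 + B (i'.val + 1) + 1) (pathList (n - i'.val))).map (fun b =>
          Step.u :: (aj.1 ++ Step.d :: b))))

/-! ### The Egge–Mansour map -/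

/-- The height of the path above abscissa `x`, for `0 ≤ x ≤` its total width. -/
noncomputable def height : Path → ℝ → ℝ
  | [], _ => 0
  | s :: p, x =>
    if x ≤ s.width then (s.rise / s.width : ℝ) * x
    else (s.rise : ℝ) + height p (x - s.width)

/-- A pair `(X, Y)` stands for the point `(X/4, Y/4)` of the plane. -/
abbrev Dot := ℕ × ℕ

/-- The point of the dot lies beneath the path and above the `x`-axis. -/
def Beneath (p : Path) (P : Dot) : Prop :=
  0 < (P.2 : ℝ) / 4 ∧ (P.2 : ℝ) / 4 < height p ((P.1 : ℝ) / 4)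

open Classical in
/-- The points `((8m+1)/4, (8a+5)/4)` and `((8m+5)/4, (8a+1)/4)`, `0 ≤ a, m < n`, that lie
beneath `p` and above the `x`-axis. -/
noncomputable def dots (n : ℕ) (p : Path) : Finset Dot :=
  ((Finset.range n ×ˢ Finset.range n).image (fun ma => (8 * ma.1 + 1, 8 * ma.2 + 5)) ∪
   (Finset.range n ×ˢ Finset.range n).image (fun ma => (8 * ma.1 + 5, 8 * ma.2 + 1))).filter
    (Beneath p)

/-- The index `i = (1 + x - y) / 2` of the label `s_i` of the dot at `(x, y) = (X/4, Y/4)`;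
the division is exact and `i ≥ 1` for all dots beneath a Schröder path. -/
def label (P : Dot) : ℕ := (4 + P.1 - P.2) / 8

/-- The rightmost dot of `D`. In the procedure below it is unique; the definition takes the
highest of the rightmost ones. -/
def rightmost (D : Finset Dot) : Dot :=
  (D.sup Prod.fst, (D.filter (fun P => P.1 = D.sup Prod.fst)).sup Prod.snd)

/-- The dot `Q` is reached from `P` by a line that runs to the left, parallel to the `x`-axis,
without crossing the path. -/
def Reaches (p : Path) (P Q : Dot) : Prop :=
  Q.2 = P.2 ∧ Q.1 ≤ P.1 ∧
  ∀ z : ℝ, (Q.1 : ℝ) / 4 ≤ z → z ≤ (P.1 : ℝ) / 4 → (P.2 : ℝ) / 4 ≤ height p z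

open Classical in
/-- The dots on the line drawn from `P` to the left (with `P` itself). -/
noncomputable def lineDots (n : ℕ) (p : Path) (P : Dot) : Finset Dot :=
  insert P ((dots n p).filter (Reaches p P))

/-- The leftmost dot on the line drawn from `P`. -/
noncomputable def leftEnd (n : ℕ) (p : Path) (P : Dot) : Dot :=
  ((lineDots n p P).inf' ⟨P, Finset.mem_insert_self _ _⟩ Prod.fst, P.2)

theorem rightmost_mem {D : Finset Dot} (h : D.Nonempty) : rightmost D ∈ D := by
  obtain ⟨P, hP, hPX⟩ := Finset.exists_mem_eq_sup D h Prod.fst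
  have hne : (D.filter (fun P => P.1 = D.sup Prod.fst)).Nonempty :=
    ⟨P, Finset.mem_filter.2 ⟨hP, hPX.symm⟩⟩
  obtain ⟨Q, hQ, hQY⟩ := Finset.exists_mem_eq_sup _ hne Prod.snd
  obtain ⟨hQD, hQX⟩ := Finset.mem_filter.1 hQ
  have hQr : rightmost D = Q := Prod.ext hQX.symm hQY
  rw [hQr]
  exact hQD

/-- The words `σ₁, σ₂, …` in the generators `s_i` obtained when `D` is the set of dots that
have no line yet. The word `s_k s_{k-1} ⋯ s_l` is recorded as `[k, k-1, …, l]`. -/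
noncomputable def lineWords (n : ℕ) (p : Path) (D : Finset Dot) : List (List ℕ) :=
  if h : D.Nonempty then
    let P := rightmost D
    let k := label P
    let l := label (leftEnd n p P)
    (List.range' l (k + 1 - l)).reverse :: lineWords n p (D \ lineDots n p P)
  else []
termination_by D.card
decreasing_by
  have hm : rightmost D ∉ D \ lineDots n p (rightmost D) := fun hm =>
    (Finset.mem_sdiff.1 hm).2 (Finset.mem_insert_self _ _)
  refine Finset.card_lt_card (Finset.ssubset_iff_subset_ne.2 ⟨Finset.sdiff_subset, fun he => ?_⟩)
  exact hm (by rw [he]; exact rightmost_mem h)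

/-- `s_i` applied to `π` exchanges the entries in the (one-based) positions `i` and `i + 1`,
for `1 ≤ i ≤ n`. -/
def applyGen {n : ℕ} (i : ℕ) (π : Equiv.Perm (Fin (n + 1))) : Equiv.Perm (Fin (n + 1)) :=
  if h : i < n + 1 then π * Equiv.swap ⟨i - 1, by omega⟩ ⟨i, h⟩ else π

/-- A word in the generators applied to `π`, its last letter first. -/
def applyWord {n : ℕ} (σ : List ℕ) (π : Equiv.Perm (Fin (n + 1))) :
    Equiv.Perm (Fin (n + 1)) :=
  σ.foldr applyGen π

/-- `φ(p) = σ_j ⋯ σ₂ σ₁ (n+1, n, …, 1)`. -/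
noncomputable def phi (n : ℕ) (p : Path) : Equiv.Perm (Fin (n + 1)) :=
  (lineWords n p (dots n p)).foldl (fun π σ => applyWord σ π) Fin.revPerm

/-- The list `Φₙ = (φ(𝒮ₙ(1)), φ(𝒮ₙ(2)), …)`. -/
noncomputable def permList (n : ℕ) : List (Equiv.Perm (Fin (n + 1))) :=
  (pathList n).map (phi n)

/-! ### Pattern avoidance and Gray codes -/

/-- `π` has a subsequence that is order-isomorphic to `τ`. -/
def ContainsPattern {N k : ℕ} (π : Equiv.Perm (Fin N)) (τ : Fin k → ℕ) : Prop :=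
  ∃ f : Fin k → Fin N, StrictMono f ∧ ∀ a b, π (f a) < π (f b) ↔ τ a < τ b

/-- The set `𝔖_N(1243, 2143)`. -/
def schroderPerms (N : ℕ) : Set (Equiv.Perm (Fin N)) :=
  {π | ¬ ContainsPattern π ![1, 2, 4, 3] ∧ ¬ ContainsPattern π ![2, 1, 4, 3]}

/-- The number of places in which two permutations differ. -/
def permDist {N : ℕ} (σ τ : Equiv.Perm (Fin N)) : ℕ := hammingDist (⇑σ) (⇑τ)

/-- `L` lists every element of `A` exactly once, and nothing else, and consecutive entries
have distance at most `k`. -/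
def IsGrayCode {α : Type*} (dist : α → α → ℕ) (k : ℕ) (A : Set α) (L : List α) : Prop :=
  L.Nodup ∧ (∀ x, x ∈ L ↔ x ∈ A) ∧
  ∀ (q : ℕ) (hq : q + 1 < L.length), dist L[q] L[q + 1] ≤ k

end SchroderGray

/-!
A nonempty Schröder path is `e p` or `u p d q` by its first return to the axis. For `u p d q`, the
lines under `q` are drawn first, then a single line along the bottom row of the first arch, then
the lines under `p`. If `i` is the semilength of `p` and `g_p` is the permutation of positions with
`φ(p)(x) = n - g_p(x)` (counting from `0`), this means that `g_{ep}` is `g_p` shifted by one, and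

  `g_{u p d q} = (g_q shifted by i + 1) · (0 → 1 → ⋯ → i + 1 → 0) · g_p`.

The last formula can be undone at the position `i + 1` of the maximum, the value `0` of `g`: if
`1243` and `2143` are avoided, the values greater than `i + 1` before this position all stand in one
place, and filling that place by the missing small value splits the permutation into `g_p` and
`g_q`. Hence `φ` is a bijection, by induction.

The Hamming distance of permutations is invariant under multiplication from both sides, so that
replacing `p` or `q` by a neighbour in its list changes `u p d q` and its permutation in at most as
many places. What remains are the junctions between consecutive blocks of `𝒮ₙ`; there `p` and `q`
are the end entries `eᵏ` and `u eᵏ⁻¹ d` of their lists.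
-/

namespace SchroderGray

/-! ### First-return decomposition -/

/-- The path `u p d q`. -/
def archPath (p q : Path) : Path := Step.u :: (p ++ Step.d :: q)

/-- Schröder paths of given semilength by their first return to the axis: every nonempty one is
`e p` or `u p d q` with shorter Schröder paths `p` and `q`. -/
inductive Decomposed : ℕ → Path → Prop
  | nil : Decomposed 0 []
  | level {n p} : Decomposed n p → Decomposed (n + 1) (Step.e :: p)
  | arch {i m p q} : Decomposed i p → Decomposed m q → Decomposed (i + m + 1) (archPath p q)

theorem decomposed_zero_iff {p : Path} : Decomposed 0 p ↔ p = [] :=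
  ⟨fun h => by cases h; rfl, fun h => h ▸ .nil⟩

theorem decomposed_succ_iff {n : ℕ} {p : Path} :
    Decomposed (n + 1) p ↔ (∃ p', Decomposed n p' ∧ p = Step.e :: p') ∨
      ∃ i m p₁ p₂, i + m = n ∧ Decomposed i p₁ ∧ Decomposed m p₂ ∧ p = archPath p₁ p₂ := by
  constructor
  · intro h
    cases h with
    | level h => exact .inl ⟨_, h, rfl⟩
    | arch h₁ h₂ => exact .inr ⟨_, _, _, _, rfl, h₁, h₂, rfl⟩
  · rintro (⟨p', h, rfl⟩ | ⟨i, m, p₁, p₂, rfl, h₁, h₂, rfl⟩)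
    exacts [.level h, .arch h₁ h₂]

/-- The horizontal displacement of a path. -/
def totalWidth (p : Path) : ℕ := (p.map Step.width).sum

/-- The vertical displacement of a path. -/
def totalRise (p : Path) : ℤ := (p.map Step.rise).sum

@[simp] theorem totalWidth_nil : totalWidth [] = 0 := rfl

@[simp] theorem totalWidth_cons (s : Step) (p : Path) :
    totalWidth (s :: p) = s.width + totalWidth p := by
  simp [totalWidth]

@[simp] theorem totalWidth_append (p q : Path) :
    totalWidth (p ++ q) = totalWidth p + totalWidth q := by
  simp [totalWidth]

@[simp] theorem totalRise_nil : totalRise [] = 0 := rfl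

@[simp] theorem totalRise_cons (s : Step) (p : Path) :
    totalRise (s :: p) = s.rise + totalRise p := by
  simp [totalRise]

@[simp] theorem totalRise_append (p q : Path) :
    totalRise (p ++ q) = totalRise p + totalRise q := by
  simp [totalRise]

/-- The path `p`, started at height `h`, never goes below the `x`-axis. -/
def StaysAbove (h : ℤ) (p : Path) : Prop := ∀ q : Path, q <+: p → 0 ≤ h + totalRise q

theorem StaysAbove.nonneg {h : ℤ} {p : Path} (H : StaysAbove h p) : 0 ≤ h := by
  simpa using H [] List.nil_prefix

theorem StaysAbove.mono {h k : ℤ} {p : Path} (H : StaysAbove h p) (hk : h ≤ k) :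
    StaysAbove k p := fun q hq => by
  have := H q hq
  omega

theorem staysAbove_nil {h : ℤ} : StaysAbove h [] ↔ 0 ≤ h := by
  simp [StaysAbove]

theorem staysAbove_cons {h : ℤ} {s : Step} {p : Path} :
    StaysAbove h (s :: p) ↔ 0 ≤ h ∧ StaysAbove (h + s.rise) p := by
  constructor
  · refine fun H => ⟨H.nonneg, fun q hq => ?_⟩
    simpa [add_assoc] using H (s :: q) (List.cons_prefix_cons.2 ⟨rfl, hq⟩)
  · rintro ⟨h0, H⟩ q hq
    rcases List.prefix_cons_iff.1 hq with rfl | ⟨t, rfl, ht⟩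
    · simpa using h0
    · simpa [add_assoc] using H t ht

theorem staysAbove_append {p q : Path} {h : ℤ} :
    StaysAbove h (p ++ q) ↔ StaysAbove h p ∧ StaysAbove (h + totalRise p) q := by
  induction p generalizing h with
  | nil =>
    simp only [List.nil_append, staysAbove_nil, totalRise_nil, add_zero]
    exact ⟨fun H => ⟨H.nonneg, H⟩, And.right⟩
  | cons s p ih =>
    simp only [List.cons_append, staysAbove_cons, ih, totalRise_cons, and_assoc, add_assoc]

theorem isSchroderPath_iff {n : ℕ} {p : Path} :
    IsSchroderPath n p ↔ totalWidth p = 2 * n ∧ totalRise p = 0 ∧ StaysAbove 0 p := by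
  simp [IsSchroderPath, StaysAbove, totalWidth, totalRise]

theorem Decomposed.totalWidth_eq {n : ℕ} {p : Path} (h : Decomposed n p) :
    totalWidth p = 2 * n := by
  induction h with
  | nil => rfl
  | level _ ih =>
    rw [totalWidth_cons, ih, Step.width]
    ring
  | arch _ _ ihp ihq =>
    simp only [archPath, totalWidth_cons, totalWidth_append, ihp, ihq, Step.width]
    ring

theorem Decomposed.totalRise_eq {n : ℕ} {p : Path} (h : Decomposed n p) : totalRise p = 0 := by
  induction h with
  | nil => rfl
  | level _ ih => simp [ih, Step.rise]
  | arch _ _ ihp ihq => simp [archPath, ihp, ihq, Step.rise]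

theorem Decomposed.staysAbove {n : ℕ} {p : Path} (h : Decomposed n p) : StaysAbove 0 p := by
  induction h with
  | nil => exact staysAbove_nil.2 le_rfl
  | level _ ih => simpa [staysAbove_cons, Step.rise] using ih
  | arch hp _ ihp ihq =>
    simp [archPath, staysAbove_cons, staysAbove_append, Step.rise, hp.totalRise_eq, ihq,
      ihp.mono zero_le_one]

theorem exists_first_passage (p : Path) {h : ℤ} (h0 : 0 ≤ h) (hp : h + totalRise p < 0) :
    ∃ p₁ p₂, p = p₁ ++ Step.d :: p₂ ∧ h + totalRise p₁ = 0 ∧ StaysAbove h p₁ := by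
  induction p generalizing h with
  | nil =>
    rw [totalRise_nil] at hp
    omega
  | cons s p ih =>
    rcases le_or_gt 0 (h + s.rise) with hs | hs
    · obtain ⟨p₁, p₂, rfl, hrise, habove⟩ := ih hs (by simpa [add_assoc] using hp)
      exact ⟨s :: p₁, p₂, rfl, by simpa [add_assoc] using hrise, staysAbove_cons.2 ⟨h0, habove⟩⟩
    · obtain ⟨rfl, rfl⟩ : s = Step.d ∧ h = 0 := by
        cases s <;> simp only [Step.rise, reduceCtorEq, true_and, false_and] at hs ⊢ <;> omega
      exact ⟨[], p, rfl, rfl, staysAbove_nil.2 h0⟩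

theorem exists_decomposed_of_staysAbove (p : Path) (hrise : totalRise p = 0)
    (habove : StaysAbove 0 p) : ∃ n, Decomposed n p := by
  match p with
  | [] => exact ⟨0, .nil⟩
  | .e :: p =>
    simp only [totalRise_cons, staysAbove_cons, Step.rise, zero_add, le_refl, true_and]
      at hrise habove
    obtain ⟨n, hn⟩ := exists_decomposed_of_staysAbove p hrise habove
    exact ⟨n + 1, .level hn⟩
  | .d :: p => exact absurd (staysAbove_cons.1 habove).2.nonneg (by decide)
  | .u :: p =>
    have hpass : 0 + totalRise p < 0 := by
      rw [totalRise_cons, Step.rise] at hrise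
      omega
    obtain ⟨p₁, p₂, rfl, hrise₁, habove₁⟩ := exists_first_passage p le_rfl hpass
    rw [zero_add] at hrise₁
    simp only [totalRise_cons, totalRise_append, staysAbove_cons, staysAbove_append, Step.rise,
      hrise₁] at hrise habove
    obtain ⟨i, hi⟩ := exists_decomposed_of_staysAbove p₁ hrise₁ habove₁
    obtain ⟨m, hm⟩ := exists_decomposed_of_staysAbove p₂ (by omega) (by simpa using habove.2.2.2)
    exact ⟨i + m + 1, .arch hi hm⟩
termination_by p.length

theorem isSchroderPath_iff_decomposed {n : ℕ} {p : Path} :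
    IsSchroderPath n p ↔ Decomposed n p := by
  rw [isSchroderPath_iff]
  constructor
  · rintro ⟨hwidth, hrise, habove⟩
    obtain ⟨m, hm⟩ := exists_decomposed_of_staysAbove p hrise habove
    obtain rfl : m = n := by
      have := hm.totalWidth_eq
      omega
    exact hm
  · exact fun h => ⟨h.totalWidth_eq, h.totalRise_eq, h.staysAbove⟩

theorem Decomposed.unique {n m : ℕ} {p : Path} (h : Decomposed n p) (h' : Decomposed m p) :
    n = m := by
  have := h.totalWidth_eq
  have := h'.totalWidth_eq
  omega

theorem Decomposed.ne_append_down {i i' : ℕ} {p p' : Path} (hp : Decomposed i p)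
    (hp' : Decomposed i' p') (r : Path) : p' ≠ p ++ Step.d :: r := by
  rintro rfl
  have habove := (staysAbove_cons.1 (staysAbove_append.1 hp'.staysAbove).2).2.nonneg
  simp [hp.totalRise_eq, Step.rise] at habove

theorem Decomposed.archPath_inj {i i' : ℕ} {p p' q q' : Path} (hp : Decomposed i p)
    (hp' : Decomposed i' p') : archPath p q = archPath p' q' ↔ p = p' ∧ q = q' := by
  refine ⟨fun h => ?_, fun ⟨h₁, h₂⟩ => h₁ ▸ h₂ ▸ rfl⟩
  rcases List.append_eq_append_iff.1 (List.cons.inj h).2 with ⟨r, h₁, h₂⟩ | ⟨r, h₁, h₂⟩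
  all_goals
    cases r with
    | nil => simp_all
    | cons s r =>
      obtain rfl : Step.d = s := (List.cons.inj h₂).1
      first
        | exact absurd h₁ (hp.ne_append_down hp' r)
        | exact absurd h₁ (hp'.ne_append_down hp r)

/-! ### The height of a path -/

theorem Step.width_pos (s : Step) : 0 < s.width := by cases s <;> simp [Step.width]

theorem height_zero (p : Path) : height p 0 = 0 := by
  cases p <;> simp [height]

theorem height_cons_of_le {s : Step} {p : Path} {x : ℝ} (h : x ≤ s.width) :
    height (s :: p) x = (s.rise / s.width : ℝ) * x := by
  rw [height, if_pos h]

theorem height_cons_of_ge {s : Step} {p : Path} {x : ℝ} (h : (s.width : ℝ) ≤ x) :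
    height (s :: p) x = s.rise + height p (x - s.width) := by
  rcases h.eq_or_lt with rfl | h
  · have hs : (s.width : ℝ) ≠ 0 := mod_cast s.width_pos.ne'
    rw [height_cons_of_le le_rfl, sub_self, height_zero, div_mul_cancel₀ _ hs, add_zero]
  · rw [height, if_neg h.not_ge]

theorem height_append_of_le {p q : Path} {x : ℝ} (h0 : 0 ≤ x) (hx : x ≤ totalWidth p) :
    height (p ++ q) x = height p x := by
  induction p generalizing x with
  | nil =>
    obtain rfl : x = 0 := le_antisymm (by simpa using hx) h0
    rw [height_zero, height_zero]
  | cons s p ih =>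
    rw [totalWidth_cons, Nat.cast_add] at hx
    rw [List.cons_append]
    rcases le_total x s.width with h | h
    · rw [height_cons_of_le h, height_cons_of_le h]
    · rw [height_cons_of_ge h, height_cons_of_ge h, ih (by linarith) (by linarith)]

theorem height_append_of_ge {p q : Path} {x : ℝ} (hx : (totalWidth p : ℝ) ≤ x) :
    height (p ++ q) x = totalRise p + height q (x - totalWidth p) := by
  induction p generalizing x with
  | nil => simp
  | cons s p ih =>
    rw [totalWidth_cons, Nat.cast_add] at hx
    have hp : (0 : ℝ) ≤ totalWidth p := Nat.cast_nonneg _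
    rw [List.cons_append, height_cons_of_ge (by linarith), ih (by linarith), totalWidth_cons,
      totalRise_cons]
    push_cast
    rw [sub_sub, add_assoc]

theorem height_level_of_le {p : Path} {x : ℝ} (h : x ≤ 2) : height (Step.e :: p) x = 0 := by
  rw [height_cons_of_le (by simpa [Step.width] using h)]
  simp [Step.rise]

theorem height_level_of_ge {p : Path} {x : ℝ} (h : 2 ≤ x) :
    height (Step.e :: p) x = height p (x - 2) := by
  rw [height_cons_of_ge (by simpa [Step.width] using h)]
  simp [Step.rise, Step.width]

section ArchHeight

variable {i : ℕ} {p q : Path} {x : ℝ}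

theorem height_arch_of_le_one (h : x ≤ 1) : height (archPath p q) x = x := by
  rw [archPath, height_cons_of_le (by simpa [Step.width] using h)]
  simp [Step.rise, Step.width]

theorem height_arch_of_ge_one (h : 1 ≤ x) :
    height (archPath p q) x = 1 + height (p ++ Step.d :: q) (x - 1) := by
  rw [archPath, height_cons_of_ge (by simpa [Step.width] using h)]
  simp [Step.rise, Step.width]

theorem height_arch_inner (hp : Decomposed i p) (h : 1 ≤ x) (h' : x ≤ 2 * i + 1) :
    height (archPath p q) x = 1 + height p (x - 1) := by
  rw [height_arch_of_ge_one h, height_append_of_le (by linarith)]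
  rw [hp.totalWidth_eq]
  push_cast
  linarith

theorem height_arch_of_ge (hp : Decomposed i p) (h : 2 * i + 1 ≤ x) :
    height (archPath p q) x = 1 + height (Step.d :: q) (x - (2 * i + 1)) := by
  have hi : (0 : ℝ) ≤ i := Nat.cast_nonneg _
  have hwidth : (totalWidth p : ℝ) = 2 * i := mod_cast hp.totalWidth_eq
  rw [height_arch_of_ge_one (by linarith), height_append_of_ge (by linarith), hp.totalRise_eq,
    hwidth]
  ring_nf

theorem height_arch_down (hp : Decomposed i p) (h : 2 * i + 1 ≤ x) (h' : x ≤ 2 * i + 2) :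
    height (archPath p q) x = 2 * i + 2 - x := by
  rw [height_arch_of_ge hp h, height_cons_of_le (by rw [Step.width]; push_cast; linarith)]
  simp only [Step.rise, Step.width]
  push_cast
  ring

theorem height_arch_outer (hp : Decomposed i p) (h : 2 * i + 2 ≤ x) :
    height (archPath p q) x = height q (x - (2 * i + 2)) := by
  rw [height_arch_of_ge hp (by linarith),
    height_cons_of_ge (by rw [Step.width]; push_cast; linarith)]
  simp only [Step.rise, Step.width]
  push_cast
  ring_nf

end ArchHeight

theorem Decomposed.height_mem_Icc {n : ℕ} {p : Path} (hp : Decomposed n p) {x : ℝ}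
    (h0 : 0 ≤ x) (hx : x ≤ 2 * n) : height p x ∈ Set.Icc 0 x := by
  induction hp generalizing x with
  | nil => simpa [height] using h0
  | level hp ih =>
    push_cast at hx
    rcases le_total x 2 with h | h
    · rw [height_level_of_le h]
      exact ⟨le_rfl, h0⟩
    · rw [height_level_of_ge h]
      exact Set.Icc_subset_Icc_right (by linarith) (ih (by linarith) (by linarith))
  | @arch i m p q hp hq ihp ihq =>
    push_cast at hx
    have hi : (0 : ℝ) ≤ i := Nat.cast_nonneg _
    rcases le_total x 1 with h₁ | h₁
    · rw [height_arch_of_le_one h₁]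
      exact ⟨h0, le_rfl⟩
    rcases le_total x (2 * i + 1) with h₂ | h₂
    · rw [height_arch_inner hp h₁ h₂]
      have := ihp (x := x - 1) (by linarith) (by linarith)
      exact ⟨by linarith [this.1], by linarith [this.2]⟩
    rcases le_total x (2 * i + 2) with h₃ | h₃
    · rw [height_arch_down hp h₂ h₃]
      exact ⟨by linarith, by linarith⟩
    · rw [height_arch_outer hp h₃]
      exact Set.Icc_subset_Icc_right (by linarith) (ihq (by linarith) (by linarith))

theorem Decomposed.height_le_of_lt {n : ℕ} {p : Path} (hp : Decomposed n p) {X : ℕ}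
    (hX : X < 8 * n) : height p ((X : ℝ) / 4) ≤ X / 4 := by
  have hX' : (X : ℝ) ≤ 8 * n := mod_cast hX.le
  exact (hp.height_mem_Icc (by positivity) (by linarith)).2

theorem Decomposed.mem_dots {n : ℕ} {p : Path} (hp : Decomposed n p) {P : Dot} :
    P ∈ dots n p ↔ ((P.1 % 8 = 1 ∧ P.2 % 8 = 5) ∨ (P.1 % 8 = 5 ∧ P.2 % 8 = 1)) ∧ P.1 < 8 * n ∧
      (P.2 : ℝ) / 4 < height p ((P.1 : ℝ) / 4) := by
  obtain ⟨X, Y⟩ := P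
  simp only [dots, Finset.mem_filter, Finset.mem_union, Finset.mem_image, Finset.mem_product,
    Finset.mem_range, Prod.exists, Prod.mk.injEq, Beneath]
  constructor
  · rintro ⟨⟨m, a, ⟨hm, ha⟩, rfl, rfl⟩ | ⟨m, a, ⟨hm, ha⟩, rfl, rfl⟩, -, h⟩
    all_goals exact ⟨by omega, by omega, h⟩
  · rintro ⟨hmod, hX, hheight⟩
    have hYX : Y < X := by
      have := hp.height_le_of_lt hX
      exact_mod_cast (by linarith : (Y : ℝ) < X)
    have hY : (0 : ℝ) < Y := mod_cast (by omega : 0 < Y)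
    refine ⟨hmod.imp (fun hmod => ?_) (fun hmod => ?_), by positivity, hheight⟩
    all_goals exact ⟨X / 8, Y / 8, by omega, by omega, by omega⟩

theorem Decomposed.snd_lt_fst {n : ℕ} {p : Path} (hp : Decomposed n p) {P : Dot}
    (hP : P ∈ dots n p) : P.2 < P.1 := by
  obtain ⟨-, hX, hheight⟩ := hp.mem_dots.1 hP
  have := hp.height_le_of_lt hX
  exact_mod_cast (by linarith : (P.2 : ℝ) < P.1)

/-! ### Lines -/

theorem rightmost_eq {D : Finset Dot} {P : Dot} (hP : P ∈ D)
    (h : ∀ Q ∈ D, Q.1 ≤ P.1 ∧ (Q.1 = P.1 → Q.2 ≤ P.2)) : rightmost D = P := by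
  have hfst : D.sup Prod.fst = P.1 :=
    le_antisymm (Finset.sup_le fun Q hQ => (h Q hQ).1) (Finset.le_sup (f := Prod.fst) hP)
  refine Prod.ext hfst (le_antisymm (Finset.sup_le fun Q hQ => ?_)
    (Finset.le_sup (f := Prod.snd) (Finset.mem_filter.2 ⟨hP, hfst.symm⟩)))
  obtain ⟨hQ, hQfst⟩ := Finset.mem_filter.1 hQ
  exact (h Q hQ).2 (hQfst.trans hfst)

theorem le_rightmost {D : Finset Dot} {Q : Dot} (hQ : Q ∈ D) :
    Q.1 ≤ (rightmost D).1 ∧ (Q.1 = (rightmost D).1 → Q.2 ≤ (rightmost D).2) :=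
  ⟨Finset.le_sup (f := Prod.fst) hQ, fun h =>
    Finset.le_sup (f := Prod.snd) (Finset.mem_filter.2 ⟨hQ, h⟩)⟩

theorem mem_lineDots {n : ℕ} {p : Path} {P Q : Dot} :
    Q ∈ lineDots n p P ↔ Q = P ∨ Q ∈ dots n p ∧ Reaches p P Q := by
  classical
  simp [lineDots]

theorem lineDots_subset {n : ℕ} {p : Path} {P : Dot} (hP : P ∈ dots n p) :
    lineDots n p P ⊆ dots n p := by
  intro Q hQ
  rcases mem_lineDots.1 hQ with rfl | hQ
  exacts [hP, hQ.1]

theorem leftEnd_mem_lineDots (n : ℕ) (p : Path) (P : Dot) : leftEnd n p P ∈ lineDots n p P := by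
  obtain ⟨Q, hQ, hfst⟩ := Finset.exists_mem_eq_inf' (s := lineDots n p P)
    ⟨P, Finset.mem_insert_self _ _⟩ Prod.fst
  have hsnd : Q.2 = P.2 := by
    rcases mem_lineDots.1 hQ with rfl | hQ
    exacts [rfl, hQ.2.1]
  have hend : leftEnd n p P = Q := Prod.ext hfst hsnd.symm
  rwa [hend]

theorem leftEnd_eq {n : ℕ} {p : Path} {P Q : Dot} (hQ : Q ∈ lineDots n p P)
    (hle : ∀ R ∈ lineDots n p P, Q.1 ≤ R.1) (hsnd : Q.2 = P.2) : leftEnd n p P = Q :=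
  Prod.ext (le_antisymm (Finset.inf'_le Prod.fst hQ)
    (Finset.le_inf' ⟨P, Finset.mem_insert_self _ _⟩ Prod.fst hle)) hsnd.symm

theorem lineWords_empty (n : ℕ) (p : Path) : lineWords n p ∅ = [] := by
  rw [lineWords, dif_neg Finset.not_nonempty_empty]

theorem lineWords_of_nonempty {n : ℕ} {p : Path} {D : Finset Dot} (h : D.Nonempty) :
    lineWords n p D = (List.range' (label (leftEnd n p (rightmost D)))
      (label (rightmost D) + 1 - label (leftEnd n p (rightmost D)))).reverse ::
        lineWords n p (D \ lineDots n p (rightmost D)) := by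
  rw [lineWords, dif_pos h]

/-! ### Translated parts of a path -/

/-- The dot `P`, moved by `(b + 8c, b)` in quarters: such moves map the dots of a path to those
of another one and shift all labels by `c`. -/
def translate (b c : ℕ) (P : Dot) : Dot := (P.1 + (b + 8 * c), P.2 + b)

theorem translate_injective (b c : ℕ) : Function.Injective (translate b c) := by
  intro P Q h
  simp only [translate, Prod.mk.injEq, Nat.add_right_cancel_iff] at h
  exact Prod.ext h.1 h.2

theorem exists_translate_eq {b c : ℕ} {Q : Dot} (hfst : b + 8 * c ≤ Q.1) (hsnd : b ≤ Q.2) :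
    ∃ P, translate b c P = Q :=
  ⟨(Q.1 - (b + 8 * c), Q.2 - b), Prod.ext (Nat.sub_add_cancel hfst) (Nat.sub_add_cancel hsnd)⟩

theorem label_translate {b c : ℕ} {P : Dot} (h : P.2 < P.1) :
    label (translate b c P) = label P + c := by
  simp only [label, translate]
  omega

theorem rightmost_image_translate_union {b c : ℕ} {D R : Finset Dot} (hD : D.Nonempty)
    (hR : ∀ P ∈ R, P.1 < b + 8 * c) :
    rightmost (D.image (translate b c) ∪ R) = translate b c (rightmost D) := by
  refine rightmost_eq (Finset.mem_union_left _
    (Finset.mem_image_of_mem _ (rightmost_mem hD))) fun Q hQ => ?_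
  simp only [translate]
  rcases Finset.mem_union.1 hQ with hQ | hQ
  · obtain ⟨P, hP, rfl⟩ := Finset.mem_image.1 hQ
    obtain ⟨hfst, hsnd⟩ := le_rightmost hP
    simp only [translate]
    exact ⟨by omega, fun h => by have := hsnd (by omega); omega⟩
  · have := hR Q hQ
    exact ⟨by omega, fun h => by omega⟩

/-- A part of the path `p` of semilength `n` is the path `q` of semilength `m`, translated by
`(b/4 + 2c, b/4)`. -/
structure IsTranslate (m : ℕ) (q : Path) (n : ℕ) (p : Path) (b c : ℕ) : Prop where
  inner : Decomposed m q
  outer : Decomposed n p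
  four_dvd : 4 ∣ b
  width_le : 8 * m + (b + 8 * c) ≤ 8 * n
  height_eq : ∀ z : ℝ, 0 ≤ z → z ≤ 2 * m → height p (z + (b + 8 * c : ℕ) / 4) = height q z + b / 4

namespace IsTranslate

variable {m n b c : ℕ} {p q : Path}

theorem fst_lt (T : IsTranslate m q n p b c) {P : Dot} (hP : P ∈ dots m q) : P.1 < 8 * m :=
  (T.inner.mem_dots.1 hP).2.1

theorem translate_mem_dots_iff (T : IsTranslate m q n p b c) {P : Dot} (hP : P.1 < 8 * m) :
    translate b c P ∈ dots n p ↔ P ∈ dots m q := by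
  rw [T.outer.mem_dots, T.inner.mem_dots]
  have hdvd := T.four_dvd
  have hwidth := T.width_le
  have hX : (P.1 : ℝ) ≤ 8 * m := mod_cast hP.le
  have hheight := T.height_eq (P.1 / 4) (by positivity) (by linarith)
  simp only [translate]
  push_cast at hheight ⊢
  rw [add_div (P.1 : ℝ), hheight, add_div (P.2 : ℝ), add_lt_add_iff_right]
  exact and_congr (by omega) (and_congr (by omega) Iff.rfl)

theorem translate_mem_dots (T : IsTranslate m q n p b c) {P : Dot} (hP : P ∈ dots m q) :
    translate b c P ∈ dots n p := (T.translate_mem_dots_iff (T.fst_lt hP)).2 hP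

theorem reaches_iff (T : IsTranslate m q n p b c) {P Q : Dot} (hP : P ∈ dots m q) :
    Reaches p (translate b c P) (translate b c Q) ↔ Reaches q P Q := by
  have hX : (P.1 : ℝ) ≤ 8 * m := mod_cast (T.fst_lt hP).le
  have hQ : (0 : ℝ) ≤ Q.1 := Nat.cast_nonneg _
  have hheight : ∀ z, (Q.1 : ℝ) / 4 ≤ z → z ≤ (P.1 : ℝ) / 4 →
      height p (z + (b + 8 * c : ℕ) / 4) = height q z + b / 4 := fun z hz hz' =>
    T.height_eq z (by linarith) (by linarith)
  simp only [Reaches, translate, Nat.add_right_cancel_iff, Nat.add_le_add_iff_right,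
    Nat.cast_add P.1, Nat.cast_add Q.1, Nat.cast_add P.2, add_div]
  refine and_congr Iff.rfl (and_congr Iff.rfl ⟨fun H z hz hz' => ?_, fun H z hz hz' => ?_⟩)
  · have := H (z + (b + 8 * c : ℕ) / 4) (by linarith) (by linarith)
    rw [hheight z hz hz'] at this
    linarith
  · have hz₀ : (Q.1 : ℝ) / 4 ≤ z - (b + 8 * c : ℕ) / 4 := by linarith
    have hz₁ : z - (b + 8 * c : ℕ) / 4 ≤ (P.1 : ℝ) / 4 := by linarith
    have := hheight _ hz₀ hz₁
    rw [sub_add_cancel] at this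
    linarith [H _ hz₀ hz₁]

/-- The path starts at the height of the translated axis, so a line drawn below the translated
part does not reach dots in front of it. -/
theorem le_fst_of_reaches (T : IsTranslate m q n p b c) {P Q : Dot} (hP : P ∈ dots m q)
    (h : Reaches p (translate b c P) Q) : b + 8 * c ≤ Q.1 := by
  by_contra! hlt
  have hQ : (Q.1 : ℝ) ≤ (b + 8 * c : ℕ) := mod_cast hlt.le
  have hX : (0 : ℝ) ≤ P.1 := Nat.cast_nonneg _
  have hY : (0 : ℝ) < P.2 := by
    have := (T.inner.mem_dots.1 hP).1
    exact_mod_cast (by omega : 0 < P.2)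
  have hline := h.2.2 ((b + 8 * c : ℕ) / 4) (by linarith)
    (by simp only [translate, Nat.cast_add P.1]; linarith)
  have hstart := T.height_eq 0 le_rfl (by positivity)
  rw [zero_add, height_zero] at hstart
  simp only [hstart, translate, Nat.cast_add P.2] at hline
  linarith

theorem lineDots_translate (T : IsTranslate m q n p b c) {P : Dot} (hP : P ∈ dots m q) :
    lineDots n p (translate b c P) = (lineDots m q P).image (translate b c) := by
  ext Q
  simp only [mem_lineDots, Finset.mem_image]
  constructor
  · rintro (rfl | ⟨hQ, hreach⟩)
    · exact ⟨P, .inl rfl, rfl⟩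
    · obtain ⟨Q, rfl⟩ := exists_translate_eq (T.le_fst_of_reaches hP hreach)
        (hreach.1 ▸ Nat.le_add_left b P.2)
      have hlt : Q.1 < 8 * m :=
        (Nat.add_le_add_iff_right.1 hreach.2.1).trans_lt (T.fst_lt hP)
      exact ⟨Q, .inr ⟨(T.translate_mem_dots_iff hlt).1 hQ, (T.reaches_iff hP).1 hreach⟩, rfl⟩
  · rintro ⟨Q, rfl | ⟨hQ, hreach⟩, rfl⟩
    · exact .inl rfl
    · exact .inr ⟨T.translate_mem_dots hQ, (T.reaches_iff hP).2 hreach⟩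

theorem leftEnd_translate (T : IsTranslate m q n p b c) {P : Dot} (hP : P ∈ dots m q) :
    leftEnd n p (translate b c P) = translate b c (leftEnd m q P) := by
  refine leftEnd_eq ?_ ?_ rfl
  · rw [T.lineDots_translate hP]
    exact Finset.mem_image_of_mem _ (leftEnd_mem_lineDots _ _ _)
  · rw [T.lineDots_translate hP]
    intro R hR
    obtain ⟨S, hS, rfl⟩ := Finset.mem_image.1 hR
    exact Nat.add_le_add_right (Finset.inf'_le Prod.fst hS) _

theorem image_union_sdiff_lineDots (T : IsTranslate m q n p b c) {D R : Finset Dot} {P : Dot}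
    (hP : P ∈ dots m q) (hR : ∀ Q ∈ R, Q.1 < b + 8 * c) :
    (D.image (translate b c) ∪ R) \ lineDots n p (translate b c P) =
      (D \ lineDots m q P).image (translate b c) ∪ R := by
  have hdisj : Disjoint R ((lineDots m q P).image (translate b c)) := by
    refine Finset.disjoint_left.2 fun Q hQ hQ' => ?_
    obtain ⟨Q, -, rfl⟩ := Finset.mem_image.1 hQ'
    exact (hR _ hQ).not_ge (Nat.le_add_left _ _)
  rw [T.lineDots_translate hP, Finset.union_sdiff_distrib, hdisj.sdiff_eq_left,
    Finset.image_sdiff _ _ (translate_injective b c)]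

theorem lineWords_translate (T : IsTranslate m q n p b c) {D R : Finset Dot} (hD : D ⊆ dots m q)
    (hR : ∀ P ∈ R, P.1 < b + 8 * c) :
    lineWords n p (D.image (translate b c) ∪ R) =
      (lineWords m q D).map (List.map (· + c)) ++ lineWords n p R := by
  induction D using Finset.strongInduction with
  | H D ih =>
    rcases D.eq_empty_or_nonempty with rfl | hne
    · simp [lineWords_empty]
    have hmem := hD (rightmost_mem hne)
    have hssub : D \ lineDots m q (rightmost D) ⊂ D :=
      Finset.ssubset_iff_of_subset Finset.sdiff_subset |>.2 ⟨_, rightmost_mem hne, fun h =>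
        (Finset.mem_sdiff.1 h).2 (mem_lineDots.2 (.inl rfl))⟩
    rw [lineWords_of_nonempty ((hne.image _).mono Finset.subset_union_left),
      rightmost_image_translate_union hne hR, T.image_union_sdiff_lineDots hmem hR,
      ih _ hssub (Finset.sdiff_subset.trans hD), lineWords_of_nonempty hne,
      T.leftEnd_translate hmem, label_translate (T.inner.snd_lt_fst hmem),
      label_translate (T.inner.snd_lt_fst (lineDots_subset hmem (leftEnd_mem_lineDots _ _ _))),
      List.map_cons, List.cons_append, List.map_reverse]
    simp only [Nat.add_comm _ c]
    rw [List.map_add_range', Nat.add_assoc c, Nat.add_sub_add_left]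

end IsTranslate

/-! ### The words of `e p` and `u p d q` -/

/-- The words of all lines drawn beneath a path. -/
noncomputable def pathWords (n : ℕ) (p : Path) : List (List ℕ) := lineWords n p (dots n p)

theorem pathWords_nil : pathWords 0 [] = [] := by
  have hdots : dots 0 [] = ∅ := by simp [dots]
  rw [pathWords, hdots, lineWords_empty]

theorem Decomposed.isTranslate_level {n : ℕ} {p : Path} (hp : Decomposed n p) :
    IsTranslate n p (n + 1) (Step.e :: p) 0 1 where
  inner := hp
  outer := hp.level
  four_dvd := dvd_zero 4
  width_le := by omega
  height_eq z h0 _ := by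
    rw [height_level_of_ge (by norm_num; linarith)]
    norm_num

theorem dots_level {n : ℕ} {p : Path} (hp : Decomposed n p) :
    dots (n + 1) (Step.e :: p) = (dots n p).image (translate 0 1) := by
  have T := hp.isTranslate_level
  ext Q
  rw [Finset.mem_image]
  constructor
  · intro hQ
    obtain ⟨-, hX, hheight⟩ := T.outer.mem_dots.1 hQ
    have hfst : 0 + 8 * 1 ≤ Q.1 := by
      by_contra! hlt
      have hlt : (Q.1 : ℝ) ≤ 8 := mod_cast hlt.le
      rw [height_level_of_le (by linarith)] at hheight
      exact hheight.not_ge (by positivity)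
    obtain ⟨P, rfl⟩ := exists_translate_eq hfst (Nat.zero_le _)
    simp only [translate] at hX
    exact ⟨P, (T.translate_mem_dots_iff (by omega)).1 hQ, rfl⟩
  · rintro ⟨P, hP, rfl⟩
    exact T.translate_mem_dots hP

theorem pathWords_level {n : ℕ} {p : Path} (hp : Decomposed n p) :
    pathWords (n + 1) (Step.e :: p) = (pathWords n p).map (List.map (· + 1)) := by
  rw [pathWords, dots_level hp, ← Finset.union_empty (Finset.image _ _),
    hp.isTranslate_level.lineWords_translate subset_rfl (by simp), lineWords_empty,
    List.append_nil, pathWords]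

section ArchWords

variable {i m : ℕ} {p q : Path}

theorem Decomposed.isTranslate_arch_outer (hp : Decomposed i p) (hq : Decomposed m q) :
    IsTranslate m q (i + m + 1) (archPath p q) 0 (i + 1) where
  inner := hq
  outer := hp.arch hq
  four_dvd := dvd_zero 4
  width_le := by omega
  height_eq z h0 _ := by
    rw [height_arch_outer hp (by push_cast; linarith)]
    push_cast
    rw [show z + (0 + 8 * ((i : ℝ) + 1)) / 4 - (2 * i + 2) = z by ring]
    ring

theorem Decomposed.isTranslate_arch_inner (hp : Decomposed i p) (hq : Decomposed m q) :
    IsTranslate i p (i + m + 1) (archPath p q) 4 0 where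
  inner := hp
  outer := hp.arch hq
  four_dvd := dvd_rfl
  width_le := by omega
  height_eq z h0 h1 := by
    rw [height_arch_inner hp (by norm_num; linarith) (by norm_num; linarith)]
    norm_num
    ring

/-- The dots of the lowest row beneath a first arch `u p d` with `p` of semilength `i`. -/
def bottomRow (i : ℕ) : Finset Dot := (Finset.range (i + 1)).image fun k => (8 * k + 5, 1)

theorem mem_bottomRow {Q : Dot} :
    Q ∈ bottomRow i ↔ Q.1 % 8 = 5 ∧ Q.1 < 8 * (i + 1) ∧ Q.2 = 1 := by
  obtain ⟨X, Y⟩ := Q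
  simp only [bottomRow, Finset.mem_image, Finset.mem_range, Prod.mk.injEq]
  constructor
  · rintro ⟨k, hk, rfl, rfl⟩
    omega
  · rintro ⟨hmod, hX, hY⟩
    exact ⟨X / 8, by omega, by omega, hY.symm⟩

theorem rightEnd_mem_bottomRow (i : ℕ) : (8 * i + 5, 1) ∈ bottomRow i :=
  mem_bottomRow.2 ⟨by omega, by omega, rfl⟩

theorem le_height_arch (hp : Decomposed i p) {x : ℝ} (h : 1 ≤ x) (h' : x ≤ 2 * i + 5 / 4) :
    3 / 4 ≤ height (archPath p q) x := by
  rcases le_total x (2 * i + 1) with hx | hx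
  · rw [height_arch_inner hp h hx]
    linarith [(hp.height_mem_Icc (x := x - 1) (by linarith) (by linarith)).1]
  · rw [height_arch_down hp hx (by linarith)]
    linarith

theorem bottomRow_subset_dots (hp : Decomposed i p) (hq : Decomposed m q) :
    bottomRow i ⊆ dots (i + m + 1) (archPath p q) := by
  intro Q hQ
  obtain ⟨hmod, hX, hY⟩ := mem_bottomRow.1 hQ
  refine (hp.arch hq).mem_dots.2 ⟨.inr ⟨hmod, by rw [hY]⟩, by omega, ?_⟩
  have hX₀ : (5 : ℝ) ≤ Q.1 := mod_cast (by omega : 5 ≤ Q.1)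
  have hX₁ : (Q.1 : ℝ) ≤ 8 * i + 5 := mod_cast (by omega : Q.1 ≤ 8 * i + 5)
  have := le_height_arch (q := q) hp (x := (Q.1 : ℝ) / 4) (by linarith) (by linarith)
  rw [hY]
  push_cast
  linarith

theorem exists_translate_outer_eq (hp : Decomposed i p) (hq : Decomposed m q) {Q : Dot}
    (hQ : Q ∈ dots (i + m + 1) (archPath p q)) (hX : 8 * (i + 1) ≤ Q.1) :
    ∃ P ∈ dots m q, translate 0 (i + 1) P = Q := by
  have T := hp.isTranslate_arch_outer hq
  obtain ⟨P, rfl⟩ := exists_translate_eq (b := 0) ((Nat.zero_add _).trans_le hX) (Nat.zero_le _)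
  have hX' := (T.outer.mem_dots.1 hQ).2.1
  simp only [translate] at hX'
  exact ⟨P, (T.translate_mem_dots_iff (by omega)).1 hQ, rfl⟩

theorem exists_translate_inner_eq (hp : Decomposed i p) (hq : Decomposed m q) {Q : Dot}
    (hQ : Q ∈ dots (i + m + 1) (archPath p q)) (hX : Q.1 < 8 * (i + 1)) (hY : Q.2 ≠ 1) :
    ∃ P ∈ dots i p, translate 4 0 P = Q := by
  have T := hp.isTranslate_arch_inner hq
  obtain ⟨hmod, -, hheight⟩ := T.outer.mem_dots.1 hQ
  have hYX := T.outer.snd_lt_fst hQ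
  have hX' : Q.1 ≠ 8 * i + 5 := by
    intro hX'
    have hY : (5 : ℝ) ≤ Q.2 := mod_cast (by omega : 5 ≤ Q.2)
    rw [hX'] at hheight
    push_cast at hheight
    rw [height_arch_down hp (by linarith) (by linarith)] at hheight
    linarith
  obtain ⟨P, rfl⟩ := exists_translate_eq (b := 4) (c := 0) (Q := Q) (by omega) (by omega)
  simp only [translate] at hX hX' hmod
  exact ⟨P, (T.translate_mem_dots_iff (by omega)).1 hQ, rfl⟩

theorem dots_arch (hp : Decomposed i p) (hq : Decomposed m q) :
    dots (i + m + 1) (archPath p q) = (dots m q).image (translate 0 (i + 1)) ∪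
      (bottomRow i ∪ (dots i p).image (translate 4 0)) := by
  ext Q
  simp only [Finset.mem_union, Finset.mem_image]
  constructor
  · intro hQ
    rcases le_or_gt (8 * (i + 1)) Q.1 with hX | hX
    · exact .inl (exists_translate_outer_eq hp hq hQ hX)
    by_cases hY : Q.2 = 1
    · have hmod := ((hp.arch hq).mem_dots.1 hQ).1
      exact .inr (.inl (mem_bottomRow.2 ⟨by omega, hX, hY⟩))
    · exact .inr (.inr (exists_translate_inner_eq hp hq hQ hX hY))
  · rintro (⟨P, hP, rfl⟩ | hQ | ⟨P, hP, rfl⟩)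
    · exact (hp.isTranslate_arch_outer hq).translate_mem_dots hP
    · exact bottomRow_subset_dots hp hq hQ
    · exact (hp.isTranslate_arch_inner hq).translate_mem_dots hP

theorem lineDots_bottomRow (hp : Decomposed i p) (hq : Decomposed m q) :
    lineDots (i + m + 1) (archPath p q) (8 * i + 5, 1) = bottomRow i := by
  ext Q
  rw [mem_lineDots]
  constructor
  · rintro (rfl | ⟨hQ, hY, hX, -⟩)
    · exact rightEnd_mem_bottomRow i
    · have hmod := ((hp.arch hq).mem_dots.1 hQ).1
      dsimp only at hX hY
      exact mem_bottomRow.2 ⟨by omega, by omega, hY⟩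
  · intro hQ
    obtain ⟨hmod, hX, hY⟩ := mem_bottomRow.1 hQ
    have hX₀ : (5 : ℝ) ≤ Q.1 := mod_cast (by omega : 5 ≤ Q.1)
    refine .inr ⟨bottomRow_subset_dots hp hq hQ, hY, by dsimp only; omega, fun z hz hz' => ?_⟩
    push_cast at hz' ⊢
    linarith [le_height_arch (q := q) hp (x := z) (by linarith) (by linarith)]

theorem leftEnd_bottomRow (hp : Decomposed i p) (hq : Decomposed m q) :
    leftEnd (i + m + 1) (archPath p q) (8 * i + 5, 1) = (5, 1) := by
  refine leftEnd_eq ?_ ?_ rfl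
  · rw [lineDots_bottomRow hp hq]
    exact mem_bottomRow.2 ⟨rfl, by omega, rfl⟩
  · intro R hR
    rw [lineDots_bottomRow hp hq, mem_bottomRow] at hR
    dsimp only
    omega

theorem rightmost_bottomRow_union (hp : Decomposed i p) :
    rightmost (bottomRow i ∪ (dots i p).image (translate 4 0)) = (8 * i + 5, 1) := by
  refine rightmost_eq (Finset.mem_union_left _ (rightEnd_mem_bottomRow i)) fun Q hQ => ?_
  rcases Finset.mem_union.1 hQ with hQ | hQ
  · obtain ⟨hmod, hX, hY⟩ := mem_bottomRow.1 hQ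
    exact ⟨by dsimp only; omega, fun _ => hY.le⟩
  · obtain ⟨P, hP, rfl⟩ := Finset.mem_image.1 hQ
    obtain ⟨-, hX, -⟩ := hp.mem_dots.1 hP
    simp only [translate]
    omega

theorem bottomRow_union_sdiff (i : ℕ) (D : Finset Dot) :
    (bottomRow i ∪ D.image (translate 4 0)) \ bottomRow i = D.image (translate 4 0) := by
  rw [Finset.union_sdiff_left, Finset.sdiff_eq_self_iff_disjoint]
  refine Finset.disjoint_left.2 fun Q hQ hQ' => ?_
  obtain ⟨P, -, rfl⟩ := Finset.mem_image.1 hQ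
  have hY := (mem_bottomRow.1 hQ').2.2
  simp only [translate] at hY
  omega

theorem lineWords_arch_inner (hp : Decomposed i p) (hq : Decomposed m q) :
    lineWords (i + m + 1) (archPath p q) (bottomRow i ∪ (dots i p).image (translate 4 0)) =
      (List.range' 1 (i + 1)).reverse :: pathWords i p := by
  have hright : label (8 * i + 5, 1) = i + 1 := by
    simp only [label]
    omega
  have hleft : label (5, 1) = 1 := rfl
  rw [lineWords_of_nonempty ⟨_, Finset.mem_union_left _ (rightEnd_mem_bottomRow i)⟩,
    rightmost_bottomRow_union hp, leftEnd_bottomRow hp hq, lineDots_bottomRow hp hq,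
    bottomRow_union_sdiff, ← Finset.union_empty (Finset.image _ _),
    (hp.isTranslate_arch_inner hq).lineWords_translate subset_rfl (by simp), lineWords_empty,
    hright, hleft]
  simp [pathWords]

theorem pathWords_arch (hp : Decomposed i p) (hq : Decomposed m q) :
    pathWords (i + m + 1) (archPath p q) =
      (pathWords m q).map (List.map (· + (i + 1))) ++
        (List.range' 1 (i + 1)).reverse :: pathWords i p := by
  have hleft : ∀ Q ∈ bottomRow i ∪ (dots i p).image (translate 4 0), Q.1 < 0 + 8 * (i + 1) := by
    intro Q hQ
    rcases Finset.mem_union.1 hQ with hQ | hQ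
    · have := mem_bottomRow.1 hQ
      omega
    · obtain ⟨P, hP, rfl⟩ := Finset.mem_image.1 hQ
      have := (hp.mem_dots.1 hP).2.1
      simp only [translate]
      omega
  rw [pathWords, dots_arch hp hq,
    (hp.isTranslate_arch_outer hq).lineWords_translate subset_rfl hleft,
    lineWords_arch_inner hp hq, ← pathWords]

end ArchWords

/-! ### Permutations of the natural numbers -/

/-- The product of the adjacent transpositions `s_i` with the given indices, where `s_i` exchanges
the zero-based positions `i - 1` and `i`. -/
def genPerm (L : List ℕ) : Equiv.Perm ℕ := (L.map fun i => Equiv.swap (i - 1) i).prod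

@[simp] theorem genPerm_nil : genPerm [] = 1 := rfl

@[simp] theorem genPerm_cons (i : ℕ) (L : List ℕ) :
    genPerm (i :: L) = Equiv.swap (i - 1) i * genPerm L := by simp [genPerm]

@[simp] theorem genPerm_append (L M : List ℕ) : genPerm (L ++ M) = genPerm L * genPerm M := by
  simp [genPerm]

/-- A permutation acting on `k, k + 1, …` instead of `0, 1, …`. -/
def shiftPerm (k : ℕ) : Equiv.Perm ℕ →* Equiv.Perm ℕ :=
  Equiv.Perm.extendDomainHom (notMemRangeEquiv k).symm

theorem shiftPerm_apply_add (k : ℕ) (g : Equiv.Perm ℕ) (x : ℕ) :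
    shiftPerm k g (x + k) = g x + k :=
  Equiv.Perm.extendDomain_apply_image g (notMemRangeEquiv k).symm x

theorem shiftPerm_apply_of_lt {k : ℕ} (g : Equiv.Perm ℕ) {x : ℕ} (hx : x < k) :
    shiftPerm k g x = x :=
  Equiv.Perm.extendDomain_apply_not_subtype _ _ (not_not.2 (Finset.mem_range.2 hx))

theorem shiftPerm_injective (k : ℕ) : Function.Injective (shiftPerm k) :=
  Equiv.Perm.extendDomainHom_injective _

theorem shiftPerm_swap (k a b : ℕ) :
    shiftPerm k (Equiv.swap a b) = Equiv.swap (a + k) (b + k) := by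
  ext x
  rcases lt_or_ge x k with hx | hx
  · rw [shiftPerm_apply_of_lt _ hx, Equiv.swap_apply_of_ne_of_ne] <;> omega
  · obtain ⟨x, rfl⟩ := Nat.exists_eq_add_of_le' hx
    rw [shiftPerm_apply_add, (add_left_injective k).map_swap]

theorem exists_eq_shiftPerm {k : ℕ} {h : Equiv.Perm ℕ} (hk : ∀ x < k, h x = x) :
    ∃ g, shiftPerm k g = h := by
  have maps_ge : ∀ x, h x ∉ Finset.range k ↔ x ∉ Finset.range k := fun x => by
    rw [not_iff_not, Finset.mem_range, Finset.mem_range]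
    refine ⟨fun hx => ?_, fun hx => (hk x hx).symm ▸ hx⟩
    rwa [← h.injective (hk _ hx)]
  refine ⟨(notMemRangeEquiv k).permCongr (h.subtypePerm maps_ge), Equiv.ext fun x => ?_⟩
  rcases lt_or_ge x k with hx | hx
  · rw [shiftPerm_apply_of_lt _ hx, hk x hx]
  · obtain ⟨x, rfl⟩ := Nat.exists_eq_add_of_le' hx
    rw [shiftPerm_apply_add]
    exact congrArg Subtype.val ((notMemRangeEquiv k).symm_apply_apply _)

theorem genPerm_map_add {k : ℕ} {L : List ℕ} (hL : ∀ i ∈ L, 1 ≤ i) :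
    genPerm (L.map (· + k)) = shiftPerm k (genPerm L) := by
  induction L with
  | nil => simp
  | cons i L ih =>
    obtain ⟨hi, hL⟩ := List.forall_mem_cons.1 hL
    rw [List.map_cons, genPerm_cons, genPerm_cons, map_mul, shiftPerm_swap, ih hL,
      Nat.sub_add_comm hi]

/-- The cycle `0 ↦ 1 ↦ ⋯ ↦ k ↦ 0`. -/
def initialCycle (k : ℕ) : Equiv.Perm ℕ := genPerm (List.range' 1 k)

theorem initialCycle_apply (k x : ℕ) :
    initialCycle k x = if x < k then x + 1 else if x = k then 0 else x := by
  induction k generalizing x with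
  | zero => simp [initialCycle]
  | succ k ih =>
    have concat : initialCycle (k + 1) = initialCycle k * Equiv.swap k (k + 1) := by
      simp [initialCycle, List.range'_1_concat, add_comm 1 k]
    rw [concat, Equiv.Perm.mul_apply, ih, Equiv.swap_apply_def]
    split_ifs <;> omega

/-- `g` fixes every number above `n`: such permutations of `ℕ` stand for the permutations of
`0, …, n`. -/
def FixesAbove (n : ℕ) (g : Equiv.Perm ℕ) : Prop := ∀ x, n < x → g x = x

theorem FixesAbove.apply_le_iff {n : ℕ} {g : Equiv.Perm ℕ} (hg : FixesAbove n g) {x : ℕ} :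
    g x ≤ n ↔ x ≤ n := by
  constructor <;> intro hx <;> by_contra! hlt
  · rw [hg x hlt] at hx
    omega
  · have := g.injective (hg _ hlt)
    omega

theorem FixesAbove.le_of_inversion {n : ℕ} {g : Equiv.Perm ℕ} (hg : FixesAbove n g) {a b : ℕ}
    (hab : a < b) (hgab : g b < g a) : b ≤ n := by
  by_contra! hb
  rw [hg b hb] at hgab
  have ha : n < a := by
    rw [← not_le, ← hg.apply_le_iff]
    omega
  rw [hg a ha] at hgab
  omega

theorem fixesAbove_genPerm {n : ℕ} {L : List ℕ} (hL : ∀ i ∈ L, i ≤ n) :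
    FixesAbove n (genPerm L) := by
  induction L with
  | nil => exact fun x _ => rfl
  | cons i L ih =>
    obtain ⟨hi, hL⟩ := List.forall_mem_cons.1 hL
    intro x hx
    rw [genPerm_cons, Equiv.Perm.mul_apply, ih hL x hx, Equiv.swap_apply_of_ne_of_ne] <;> omega

theorem FixesAbove.of_shiftPerm {k n : ℕ} {g : Equiv.Perm ℕ}
    (h : FixesAbove (n + k) (shiftPerm k g)) : FixesAbove n g := fun x hx => by
  have := h (x + k) (by omega)
  rw [shiftPerm_apply_add] at this
  omega

theorem exists_fixesAbove_of_perm {n : ℕ} (σ : Equiv.Perm (Fin (n + 1))) :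
    ∃ g : Equiv.Perm ℕ, FixesAbove n g ∧ ∀ x : Fin (n + 1), g x = σ x :=
  ⟨σ.extendDomain Fin.equivSubtype,
    fun _ hx => Equiv.Perm.extendDomain_apply_not_subtype _ _ (by omega),
    fun x => Equiv.Perm.extendDomain_apply_image σ Fin.equivSubtype x⟩

/-! ### The permutation attached to an arch -/

/-- The position permutation of `u p d q` for `k = i + 1`, where `i` is the semilength of `p` and
`f` and `g` are the position permutations of `p` and `q`. -/
def archPerm (k : ℕ) (g f : Equiv.Perm ℕ) : Equiv.Perm ℕ :=
  shiftPerm k g * initialCycle k * f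

/-- The positions of the entries `i + 1, i + 2, …` of `archPerm (i + 1) g f`, in increasing
order. -/
def largePos (i : ℕ) (f : Equiv.Perm ℕ) : ℕ → ℕ
  | 0 => f.symm i
  | x + 1 => x + 1 + (i + 1)

section archPerm

variable {i x y : ℕ} {g f : Equiv.Perm ℕ}

theorem archPerm_apply (k : ℕ) (g f : Equiv.Perm ℕ) (x : ℕ) :
    archPerm k g f x = shiftPerm k g (initialCycle k (f x)) := rfl

theorem archPerm_apply_self (hf : FixesAbove i f) : archPerm (i + 1) g f (i + 1) = 0 := by
  rw [archPerm_apply, hf _ i.lt_succ_self, initialCycle_apply, if_neg (lt_irrefl _), if_pos rfl,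
    shiftPerm_apply_of_lt _ i.succ_pos]

theorem archPerm_apply_of_lt (hx : f x < i) : archPerm (i + 1) g f x = f x + 1 := by
  rw [archPerm_apply, initialCycle_apply, if_pos (by omega), shiftPerm_apply_of_lt _ (by omega)]

theorem archPerm_apply_of_eq (hx : f x = i) : archPerm (i + 1) g f x = g 0 + (i + 1) := by
  rw [archPerm_apply, initialCycle_apply, if_pos (by omega), hx, ← shiftPerm_apply_add, zero_add]

theorem archPerm_apply_add (hf : FixesAbove i f) (hx : 0 < x) :
    archPerm (i + 1) g f (x + (i + 1)) = g x + (i + 1) := by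
  rw [archPerm_apply, hf _ (by omega), initialCycle_apply, if_neg (by omega), if_neg (by omega),
    shiftPerm_apply_add]

theorem archPerm_apply_of_le (hf : FixesAbove i f) (hx : x ≤ i) :
    f x < i ∧ archPerm (i + 1) g f x = f x + 1 ∨
      f x = i ∧ archPerm (i + 1) g f x = g 0 + (i + 1) :=
  (hf.apply_le_iff.2 hx).lt_or_eq.imp (fun h => ⟨h, archPerm_apply_of_lt h⟩)
    fun h => ⟨h, archPerm_apply_of_eq h⟩

theorem archPerm_lt_archPerm_iff (hf : FixesAbove i f) (hx : x ≤ i) (hy : y ≤ i) :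
    archPerm (i + 1) g f x < archPerm (i + 1) g f y ↔ f x < f y := by
  have := archPerm_apply_of_le (g := g) hf hx
  have := archPerm_apply_of_le (g := g) hf hy
  omega

theorem strictMono_largePos (hf : FixesAbove i f) : StrictMono (largePos i f) := by
  have hle : f.symm i ≤ i := hf.apply_le_iff.1 (f.apply_symm_apply i).le
  refine strictMono_nat_of_lt_succ fun x => ?_
  cases x <;> simp only [largePos] <;> omega

theorem archPerm_largePos (hf : FixesAbove i f) (x : ℕ) :
    archPerm (i + 1) g f (largePos i f x) = g x + (i + 1) := by
  cases x with
  | zero => exact archPerm_apply_of_eq (f.apply_symm_apply i)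
  | succ x => exact archPerm_apply_add hf x.succ_pos

theorem exists_largePos_eq (hf : FixesAbove i f) (hx : i + 1 ≤ archPerm (i + 1) g f x) :
    ∃ y, largePos i f y = x := by
  refine ⟨g.symm (archPerm (i + 1) g f x - (i + 1)), (archPerm (i + 1) g f).injective ?_⟩
  rw [archPerm_largePos hf, Equiv.apply_symm_apply, Nat.sub_add_cancel hx]

theorem archPerm_inj {i' : ℕ} {g' f' : Equiv.Perm ℕ} (hf : FixesAbove i f)
    (hf' : FixesAbove i' f') (h : archPerm (i + 1) g f = archPerm (i' + 1) g' f') :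
    i = i' ∧ g = g' ∧ f = f' := by
  obtain rfl : i = i' := by
    have hzero := (archPerm_apply_self (g := g) hf).trans (archPerm_apply_self (g := g') hf').symm
    rw [h] at hzero
    have := (archPerm (i' + 1) g' f').injective hzero
    omega
  obtain rfl : f = f' := by
    ext x
    rcases le_or_gt x i with hx | hx
    · have hfx := archPerm_apply_of_le (g := g) hf hx
      have hfx' := archPerm_apply_of_le (g := g') hf' hx
      rw [h] at hfx
      omega
    · rw [hf x hx, hf' x hx]
  rw [archPerm, archPerm, mul_left_inj, mul_left_inj] at h
  exact ⟨rfl, shiftPerm_injective _ h, rfl⟩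

theorem shiftPerm_one_ne_archPerm {g' : Equiv.Perm ℕ} (hf : FixesAbove i f) :
    shiftPerm 1 g' ≠ archPerm (i + 1) g f := by
  intro h
  have hzero : archPerm (i + 1) g f 0 = 0 := h ▸ shiftPerm_apply_of_lt g' zero_lt_one
  exact i.succ_ne_zero.symm
    ((archPerm (i + 1) g f).injective (hzero.trans (archPerm_apply_self hf).symm))

end archPerm

/-! ### Pattern avoidance -/

/-- The sequence `n - g 0, n - g 1, …` avoids `1243` and `2143`. -/
def Avoids (g : Equiv.Perm ℕ) : Prop :=
  ∀ ⦃a b c d⦄, a < b → b < c → c < d → g c < g d → g d < g a → g d < g b → False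

theorem avoids_one : Avoids 1 := fun _ _ _ _ hab hbc hcd _ hda _ =>
  lt_asymm hda (hab.trans (hbc.trans hcd))

theorem avoids_shiftPerm_iff {k : ℕ} {g : Equiv.Perm ℕ} : Avoids (shiftPerm k g) ↔ Avoids g := by
  constructor <;> intro hg a b c d hab hbc hcd hgcd hgda hgdb
  · refine hg (Nat.add_lt_add_right hab k) (Nat.add_lt_add_right hbc k)
      (Nat.add_lt_add_right hcd k) ?_ ?_ ?_ <;>
      simpa only [shiftPerm_apply_add, add_lt_add_iff_right]
  · have ha : k ≤ a := by
      by_contra! ha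
      have hd : shiftPerm k g d < k := hgda.trans (by rwa [shiftPerm_apply_of_lt g ha])
      have := (shiftPerm k g).injective (shiftPerm_apply_of_lt g hd)
      rw [shiftPerm_apply_of_lt g ha] at hgda
      omega
    obtain ⟨a, rfl⟩ := Nat.exists_eq_add_of_le' ha
    obtain ⟨b, rfl⟩ := Nat.exists_eq_add_of_le' (ha.trans hab.le)
    obtain ⟨c, rfl⟩ := Nat.exists_eq_add_of_le' (ha.trans (hab.trans hbc).le)
    obtain ⟨d, rfl⟩ := Nat.exists_eq_add_of_le' (ha.trans (hab.trans (hbc.trans hcd)).le)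
    simp only [shiftPerm_apply_add, add_lt_add_iff_right] at *
    exact hg hab hbc hcd hgcd hgda hgdb

theorem avoids_archPerm {i : ℕ} {g f : Equiv.Perm ℕ} (hf : FixesAbove i f) (hga : Avoids g)
    (hfa : Avoids f) : Avoids (archPerm (i + 1) g f) := by
  intro a b c d hab hbc hcd hcd' hda hdb
  rcases le_or_gt d i with hd | hd
  · rw [archPerm_lt_archPerm_iff hf (by omega) (by omega)] at hcd' hda hdb
    exact hfa hab hbc hcd hcd' hda hdb
  have hself := archPerm_apply_self (g := g) hf
  have large_of_gt : ∀ x, i + 1 < x → i + 1 ≤ archPerm (i + 1) g f x := fun x hx => by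
    obtain ⟨x, rfl⟩ := Nat.exists_eq_add_of_le' hx.le
    rw [archPerm_apply_add hf (by omega)]
    omega
  have hd' : i + 1 < d := lt_of_le_of_ne hd (by rintro rfl; omega)
  have hdl := large_of_gt d hd'
  obtain ⟨d, rfl⟩ := exists_largePos_eq hf hdl
  obtain ⟨b, rfl⟩ := exists_largePos_eq hf (hdl.trans hdb.le)
  obtain ⟨a, rfl⟩ := exists_largePos_eq hf (hdl.trans hda.le)
  -- Only the first of the large entries stands before position `i + 1`.
  have hb : i + 1 < largePos i f b := by
    obtain ⟨b, rfl⟩ := Nat.exists_eq_succ_of_ne_zero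
      ((strictMono_largePos hf).lt_iff_lt.1 hab).ne_bot
    simp only [largePos]
    omega
  obtain ⟨c, rfl⟩ := exists_largePos_eq hf (large_of_gt c (hb.trans hbc))
  rw [(strictMono_largePos hf).lt_iff_lt] at hab hbc hcd
  simp only [archPerm_largePos hf, add_lt_add_iff_right] at hcd' hda hdb
  exact hga hab hbc hcd hcd' hda hdb

theorem avoids_archPerm_iff {i : ℕ} {g f : Equiv.Perm ℕ} (hf : FixesAbove i f) :
    Avoids (archPerm (i + 1) g f) ↔ Avoids g ∧ Avoids f := by
  refine ⟨fun h => ⟨fun a b c d hab hbc hcd hcd' hda hdb => ?_,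
    fun a b c d hab hbc hcd hcd' hda hdb => ?_⟩, fun h => avoids_archPerm hf h.1 h.2⟩
  · have mono := strictMono_largePos hf
    refine h (mono hab) (mono hbc) (mono hcd) ?_ ?_ ?_ <;>
      simpa only [archPerm_largePos hf, add_lt_add_iff_right]
  · have hd : d ≤ i := hf.le_of_inversion (hab.trans (hbc.trans hcd)) hda
    refine h hab hbc hcd ?_ ?_ ?_ <;> rwa [archPerm_lt_archPerm_iff hf (by omega) (by omega)]

theorem exists_small_after_of_large_before {k a b : ℕ} {g : Equiv.Perm ℕ} (hk : g k = 0)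
    (hab : a ≠ b) (ha : a < k) (hb : b < k) (hga : k ≤ g a) (hgb : k ≤ g b) :
    ∃ d, k < d ∧ 0 < g d ∧ g d < k := by
  by_contra! H
  have hsub : (Finset.Ico 1 k).image g.symm ⊆ ((Finset.range k).erase a).erase b := by
    intro x hx
    obtain ⟨v, hv, rfl⟩ := Finset.mem_image.1 hx
    rw [Finset.mem_Ico] at hv
    have hHv := H (g.symm v)
    simp only [Finset.mem_erase, Finset.mem_range, ne_eq, Equiv.symm_apply_eq,
      Equiv.apply_symm_apply] at hHv ⊢
    have hne : g.symm v ≠ k := by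
      rw [ne_eq, Equiv.symm_apply_eq]
      omega
    omega
  have hcard := Finset.card_le_card hsub
  rw [Finset.card_image_of_injective _ g.symm.injective, Finset.card_erase_of_mem (by simp; omega),
    Finset.card_erase_of_mem (by simpa using ha), Finset.card_range, Nat.card_Ico] at hcard
  omega

theorem Avoids.eq_of_large_before {k a b : ℕ} {g : Equiv.Perm ℕ} (hg : Avoids g) (hk : g k = 0)
    (ha : a < k) (hb : b < k) (hga : k ≤ g a) (hgb : k ≤ g b) : a = b := by
  by_contra hab
  obtain ⟨d, hkd, hd_pos, hd_lt⟩ := exists_small_after_of_large_before hk hab ha hb hga hgb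
  rcases lt_or_gt_of_ne hab with hlt | hlt
  · exact hg hlt hb hkd (by omega) (by omega) (by omega)
  · exact hg hlt ha hkd (by omega) (by omega) (by omega)

/-- The entries before the position `i + 1` of `0`, lowered by one; the large one among them, if
there is one, becomes `i`. -/
theorem Avoids.exists_inner {i : ℕ} {h : Equiv.Perm ℕ} (hh : Avoids h) (hzero : h (i + 1) = 0) :
    ∃ f, FixesAbove i f ∧ ∀ x ≤ i, f x = min (h x - 1) i := by
  have h_pos : ∀ x ≤ i, 0 < h x := fun x hx => by
    by_contra! hle
    have := h.injective (hzero.trans (Nat.le_zero.1 hle).symm)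
    omega
  let F : Fin (i + 1) → Fin (i + 1) := fun x => ⟨min (h x - 1) i, by omega⟩
  have hF : Function.Injective F := by
    intro x y hxy
    have hval : min (h x - 1) i = min (h y - 1) i := Fin.val_eq_of_eq hxy
    have hx := h_pos x x.is_le
    have hy := h_pos y y.is_le
    refine Fin.ext ?_
    rcases lt_or_ge (h x) (i + 1) with hlt | hge
    · exact h.injective (by omega)
    · exact hh.eq_of_large_before hzero x.isLt y.isLt hge (by omega)
  obtain ⟨f, hf, hfF⟩ := exists_fixesAbove_of_perm (Equiv.ofBijective F hF.bijective_of_finite)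
  exact ⟨f, hf, fun x hx => hfF ⟨x, by omega⟩⟩

theorem Avoids.exists_archPerm_eq {i n : ℕ} {h : Equiv.Perm ℕ} (hh : Avoids h)
    (hn : FixesAbove n h) (hzero : h (i + 1) = 0) :
    ∃ m g f, i + m + 1 = n ∧ FixesAbove i f ∧ FixesAbove m g ∧ archPerm (i + 1) g f = h := by
  obtain ⟨f, hf, hfh⟩ := hh.exists_inner hzero
  have hfix : ∀ y < i + 1, (h * f⁻¹ * (initialCycle (i + 1))⁻¹) y = y := by
    intro y hy
    obtain ⟨x, rfl⟩ := (initialCycle (i + 1) * f).surjective y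
    have cancel : (h * f⁻¹ * (initialCycle (i + 1))⁻¹) ((initialCycle (i + 1) * f) x) = h x := by
      simp
    rw [cancel]
    rw [Equiv.Perm.mul_apply, initialCycle_apply] at hy ⊢
    rcases lt_trichotomy x (i + 1) with hx | rfl | hx
    · have hne : h x ≠ 0 := fun h0 => hx.ne (h.injective (h0.trans hzero.symm))
      have := hfh x (by omega)
      split_ifs at hy ⊢ <;> omega
    · rw [hf _ i.lt_succ_self, hzero, if_neg (lt_irrefl _), if_pos rfl]
    · rw [hf x (by omega)] at hy
      split_ifs at hy <;> omega
  obtain ⟨g, hg⟩ := exists_eq_shiftPerm hfix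
  obtain rfl : archPerm (i + 1) g f = h := by rw [archPerm, hg]; group
  have hin : i + 1 ≤ n := hn.apply_le_iff.1 (hzero.trans_le n.zero_le)
  refine ⟨n - (i + 1), g, f, by omega, hf, fun x hx => ?_, rfl⟩
  have := hn (x + (i + 1)) (by omega)
  rw [archPerm_apply_add hf (by omega)] at this
  omega

/-! ### The permutation of a path -/

/-- The letters of the words of a path, in the order in which they are applied. -/
noncomputable def pathLetters (n : ℕ) (p : Path) : List ℕ := (pathWords n p).flatMap List.reverse

/-- The effect of the words of a path on positions: `φ(p)` arises from `(n + 1, n, …, 1)` by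
precomposition with it. -/
noncomputable def pathPerm (n : ℕ) (p : Path) : Equiv.Perm ℕ := genPerm (pathLetters n p)

theorem flatMap_reverse_map_map {α β : Type*} (f : α → β) (L : List (List α)) :
    (L.map (List.map f)).flatMap List.reverse = (L.flatMap List.reverse).map f := by
  simp only [List.flatMap_map, List.map_flatMap, List.map_reverse]

theorem pathLetters_level {n : ℕ} {p : Path} (hp : Decomposed n p) :
    pathLetters (n + 1) (Step.e :: p) = (pathLetters n p).map (· + 1) := by
  rw [pathLetters, pathWords_level hp, flatMap_reverse_map_map, pathLetters]

theorem pathLetters_arch {i m : ℕ} {p q : Path} (hp : Decomposed i p) (hq : Decomposed m q) :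
    pathLetters (i + m + 1) (archPath p q) =
      (pathLetters m q).map (· + (i + 1)) ++ (List.range' 1 (i + 1) ++ pathLetters i p) := by
  rw [pathLetters, pathWords_arch hp hq, List.flatMap_append, flatMap_reverse_map_map,
    List.flatMap_cons, List.reverse_reverse, pathLetters, pathLetters]

theorem Decomposed.mem_Icc_of_mem_pathLetters {n : ℕ} {p : Path} (hp : Decomposed n p) :
    ∀ l ∈ pathLetters n p, 1 ≤ l ∧ l ≤ n := by
  induction hp with
  | nil => simp [pathLetters, pathWords_nil]
  | level hp ih =>
    rw [pathLetters_level hp, List.forall_mem_map]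
    intro l hl
    have := ih l hl
    omega
  | arch hp hq ihp ihq =>
    rw [pathLetters_arch hp hq]
    simp only [List.mem_append, List.mem_map, List.mem_range'_1]
    rintro l (⟨l, hl, rfl⟩ | hl | hl)
    · have := ihq l hl; omega
    · omega
    · have := ihp l hl; omega

theorem pathPerm_nil : pathPerm 0 [] = 1 := by
  simp [pathPerm, pathLetters, pathWords_nil]

theorem pathPerm_level {n : ℕ} {p : Path} (hp : Decomposed n p) :
    pathPerm (n + 1) (Step.e :: p) = shiftPerm 1 (pathPerm n p) := by
  rw [pathPerm, pathLetters_level hp,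
    genPerm_map_add fun l hl => (hp.mem_Icc_of_mem_pathLetters l hl).1, pathPerm]

theorem pathPerm_arch {i m : ℕ} {p q : Path} (hp : Decomposed i p) (hq : Decomposed m q) :
    pathPerm (i + m + 1) (archPath p q) = archPerm (i + 1) (pathPerm m q) (pathPerm i p) := by
  rw [pathPerm, pathLetters_arch hp hq, genPerm_append, genPerm_append,
    genPerm_map_add fun l hl => (hq.mem_Icc_of_mem_pathLetters l hl).1, archPerm, mul_assoc,
    pathPerm, pathPerm, initialCycle]

theorem Decomposed.fixesAbove {n : ℕ} {p : Path} (hp : Decomposed n p) :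
    FixesAbove n (pathPerm n p) :=
  fixesAbove_genPerm fun l hl => (hp.mem_Icc_of_mem_pathLetters l hl).2

theorem Decomposed.avoids {n : ℕ} {p : Path} (hp : Decomposed n p) : Avoids (pathPerm n p) := by
  induction hp with
  | nil => exact pathPerm_nil ▸ avoids_one
  | level hp ih => rwa [pathPerm_level hp, avoids_shiftPerm_iff]
  | arch hp hq ihp ihq =>
    rw [pathPerm_arch hp hq]
    exact avoids_archPerm hp.fixesAbove ihq ihp

theorem Decomposed.pathPerm_inj {n : ℕ} {p q : Path} (hp : Decomposed n p) (hq : Decomposed n q)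
    (h : pathPerm n p = pathPerm n q) : p = q := by
  induction hp generalizing q with
  | nil => exact (decomposed_zero_iff.1 hq).symm
  | level hp ih =>
    rcases decomposed_succ_iff.1 hq with ⟨q, hq', rfl⟩ | ⟨i, m, q, q', rfl, hq', hq'', rfl⟩
    · rw [pathPerm_level hp, pathPerm_level hq'] at h
      rw [ih hq' (shiftPerm_injective _ h)]
    · rw [pathPerm_level hp, pathPerm_arch hq' hq''] at h
      exact absurd h (shiftPerm_one_ne_archPerm hq'.fixesAbove)
  | @arch i m p p' hp hp' ih ih' =>
    rcases decomposed_succ_iff.1 hq with ⟨q, hq', rfl⟩ | ⟨j, k, q, q', hjk, hq', hq'', rfl⟩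
    · rw [pathPerm_level hq', pathPerm_arch hp hp'] at h
      exact absurd h.symm (shiftPerm_one_ne_archPerm hp.fixesAbove)
    · rw [pathPerm_arch hp hp', ← hjk, pathPerm_arch hq' hq''] at h
      obtain ⟨rfl, hperm', hperm⟩ := archPerm_inj hp.fixesAbove hq'.fixesAbove h
      obtain rfl : k = m := by omega
      rw [ih hq' hperm, ih' hq'' hperm']

theorem eq_one_of_fixesAbove_zero {g : Equiv.Perm ℕ} (hg : FixesAbove 0 g) : g = 1 := by
  ext x
  rcases x.eq_zero_or_pos with rfl | hx
  · exact Nat.le_zero.1 (hg.apply_le_iff.2 le_rfl)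
  · exact hg x hx

theorem Avoids.exists_pathPerm_eq {n : ℕ} {h : Equiv.Perm ℕ} (hh : Avoids h)
    (hn : FixesAbove n h) : ∃ p, Decomposed n p ∧ pathPerm n p = h := by
  induction n using Nat.strong_induction_on generalizing h with
  | _ n ih =>
    obtain ⟨k, hk⟩ := h.surjective 0
    rcases k with _ | i
    · rcases n with _ | n
      · exact ⟨[], .nil, pathPerm_nil.trans (eq_one_of_fixesAbove_zero hn).symm⟩
      · obtain ⟨g, rfl⟩ := exists_eq_shiftPerm (k := 1) fun x hx => by rwa [Nat.lt_one_iff.1 hx]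
        obtain ⟨p, hp, rfl⟩ := ih n n.lt_succ_self (avoids_shiftPerm_iff.1 hh) hn.of_shiftPerm
        exact ⟨_, hp.level, pathPerm_level hp⟩
    · obtain ⟨m, g, f, rfl, hf, hg, rfl⟩ := hh.exists_archPerm_eq hn hk
      obtain ⟨hga, hfa⟩ := (avoids_archPerm_iff hf).1 hh
      obtain ⟨p, hp, rfl⟩ := ih i (by omega) hfa hf
      obtain ⟨q, hq, rfl⟩ := ih m (by omega) hga hg
      exact ⟨_, hp.arch hq, pathPerm_arch hp hq⟩

/-! ### The Egge–Mansour map is a bijection -/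

theorem applyGen_apply {n i : ℕ} (hi : i ≤ n) (π : Equiv.Perm (Fin (n + 1))) {x y : Fin (n + 1)}
    (hy : (y : ℕ) = Equiv.swap (i - 1) i x) : applyGen i π x = π y := by
  rw [applyGen, dif_pos (Nat.lt_succ_of_le hi), Equiv.Perm.mul_apply]
  refine congrArg π (Fin.ext ?_)
  rw [hy, Equiv.swap_apply_def, Equiv.swap_apply_def]
  simp only [Fin.ext_iff]
  split_ifs <;> rfl

theorem foldl_applyGen_apply {n : ℕ} {L : List ℕ} (hL : ∀ l ∈ L, l ≤ n)
    (π : Equiv.Perm (Fin (n + 1))) {x y : Fin (n + 1)} (hy : (y : ℕ) = genPerm L x) :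
    L.foldl (fun π i => applyGen i π) π x = π y := by
  induction L generalizing π y with
  | nil => exact congrArg π (Fin.ext hy.symm)
  | cons i L ih =>
    obtain ⟨hi, hL⟩ := List.forall_mem_cons.1 hL
    have hlt : genPerm L x < n + 1 :=
      Nat.lt_succ_of_le ((fixesAbove_genPerm hL).apply_le_iff.2 x.is_le)
    rw [List.foldl_cons, ih hL (applyGen i π) (y := ⟨genPerm L x, hlt⟩) rfl]
    exact applyGen_apply hi π (by rw [hy, genPerm_cons, Equiv.Perm.mul_apply])

theorem phi_eq_foldl_applyGen (n : ℕ) (p : Path) :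
    phi n p = (pathLetters n p).foldl (fun π i => applyGen i π) Fin.revPerm := by
  rw [pathLetters, List.foldl_flatMap]
  simp only [phi, pathWords, applyWord, List.foldl_reverse]

theorem Decomposed.phi_apply {n : ℕ} {p : Path} (hp : Decomposed n p) (x : Fin (n + 1)) :
    (phi n p x : ℕ) = n - pathPerm n p x := by
  have hlt : pathPerm n p x < n + 1 := Nat.lt_succ_of_le (hp.fixesAbove.apply_le_iff.2 x.is_le)
  rw [phi_eq_foldl_applyGen,
    foldl_applyGen_apply (fun l hl => (hp.mem_Icc_of_mem_pathLetters l hl).2) Fin.revPerm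
      (y := ⟨pathPerm n p x, hlt⟩) rfl,
    Fin.revPerm_apply, Fin.val_rev, Nat.add_sub_add_right]

theorem mem_schroderPerms_iff {N : ℕ} {π : Equiv.Perm (Fin N)} :
    π ∈ schroderPerms N ↔
      ∀ ⦃a b c d⦄, a < b → b < c → c < d → π d < π c → π a < π d → π b < π d → False := by
  constructor
  · rintro ⟨h1243, h2143⟩ a b c d hab hbc hcd hdc had hbd
    have hmono : StrictMono ![a, b, c, d] := by
      simp [Fin.strictMono_iff_lt_succ, Fin.forall_fin_succ, hab, hbc, hcd]
    rcases (π.injective.ne hab.ne).lt_or_gt with hlt | hlt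
    · refine h1243 ⟨_, hmono, fun u v => ?_⟩
      fin_cases u <;> fin_cases v <;> simp <;> lia
    · refine h2143 ⟨_, hmono, fun u v => ?_⟩
      fin_cases u <;> fin_cases v <;> simp <;> lia
  · refine fun H => ⟨?_, ?_⟩ <;>
    · rintro ⟨f, hf, hπ⟩
      exact H (hf (show (0 : Fin 4) < 1 by decide)) (hf (show (1 : Fin 4) < 2 by decide))
        (hf (show (2 : Fin 4) < 3 by decide)) ((hπ 3 2).2 (by decide)) ((hπ 0 3).2 (by decide))
        ((hπ 1 3).2 (by decide))

theorem mem_schroderPerms_iff_avoids {n : ℕ} {π : Equiv.Perm (Fin (n + 1))} {g : Equiv.Perm ℕ}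
    (hg : FixesAbove n g) (h : ∀ x : Fin (n + 1), (π x : ℕ) = n - g x) :
    π ∈ schroderPerms (n + 1) ↔ Avoids g := by
  have lt_iff : ∀ x y : Fin (n + 1), π x < π y ↔ g y < g x := fun x y => by
    have := hg.apply_le_iff.2 x.is_le
    have := hg.apply_le_iff.2 y.is_le
    rw [Fin.lt_def, h, h]
    omega
  simp only [mem_schroderPerms_iff, lt_iff]
  refine ⟨fun H a b c d hab hbc hcd hcd' hda hdb => ?_, fun H a b c d hab hbc hcd => H hab hbc hcd⟩
  have hd : d < n + 1 := Nat.lt_succ_of_le (hg.le_of_inversion (hab.trans (hbc.trans hcd)) hda)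
  exact H (a := ⟨a, by omega⟩) (b := ⟨b, by omega⟩) (c := ⟨c, by omega⟩) (d := ⟨d, hd⟩)
    hab hbc hcd hcd' hda hdb

theorem phi_injOn (n : ℕ) : Set.InjOn (phi n) {p | Decomposed n p} := by
  intro p (hp : Decomposed n p) q (hq : Decomposed n q) h
  refine hp.pathPerm_inj hq (Equiv.ext fun x => ?_)
  rcases le_or_gt x n with hx | hx
  · have hp_apply := hp.phi_apply ⟨x, Nat.lt_succ_of_le hx⟩
    have hq_apply := hq.phi_apply ⟨x, Nat.lt_succ_of_le hx⟩
    have := hp.fixesAbove.apply_le_iff.2 hx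
    have := hq.fixesAbove.apply_le_iff.2 hx
    rw [h] at hp_apply
    dsimp only at hp_apply hq_apply
    omega
  · rw [hp.fixesAbove x hx, hq.fixesAbove x hx]

theorem phi_bijOn (n : ℕ) :
    Set.BijOn (phi n) {p | IsSchroderPath n p} (schroderPerms (n + 1)) := by
  simp only [isSchroderPath_iff_decomposed]
  refine ⟨fun p (hp : Decomposed n p) => ?_, phi_injOn n, fun π hπ => ?_⟩
  · exact (mem_schroderPerms_iff_avoids hp.fixesAbove hp.phi_apply).2 hp.avoids
  · obtain ⟨g, hg, hgπ⟩ := exists_fixesAbove_of_perm (π.trans Fin.revPerm)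
    have hπg : ∀ x, (π x : ℕ) = n - g x := fun x => by
      rw [hgπ, Equiv.trans_apply, Fin.revPerm_apply, Fin.val_rev]
      omega
    obtain ⟨p, hp, rfl⟩ := ((mem_schroderPerms_iff_avoids hg hπg).1 hπ).exists_pathPerm_eq hg
    exact ⟨p, hp, Equiv.ext fun x => Fin.ext (by rw [hp.phi_apply, hπg])⟩

/-! ### Distances -/

/-- The number of places in which two permutations differ, without restriction to a finite part
of the domain. -/
noncomputable def disagreement {α : Type*} (g h : Equiv.Perm α) : ℕ∞ := {x | g x ≠ h x}.encard

section disagreement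

variable {α : Type*} (f g h : Equiv.Perm α)

theorem disagreement_comm : disagreement g h = disagreement h g := by
  simp only [disagreement, ne_comm]

theorem disagreement_mul_left : disagreement (f * g) (f * h) = disagreement g h := by
  simp only [disagreement, Equiv.Perm.mul_apply, f.injective.ne_iff]

theorem disagreement_mul_right : disagreement (g * f) (h * f) = disagreement g h :=
  Set.encard_preimage_of_bijective f.bijective {x | g x ≠ h x}

variable {g h} in
theorem disagreement_le_card {s : Finset α} (hs : ∀ x ∉ s, g x = h x) :
    disagreement g h ≤ s.card := by
  rw [← Set.encard_coe_eq_coe_finsetCard]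
  exact Set.encard_le_encard fun x hx => by_contra fun hxs => hx (hs x hxs)

end disagreement

theorem disagreement_shiftPerm (k : ℕ) (g h : Equiv.Perm ℕ) :
    disagreement (shiftPerm k g) (shiftPerm k h) = disagreement g h := by
  have himage : {x | shiftPerm k g x ≠ shiftPerm k h x} = (· + k) '' {x | g x ≠ h x} := by
    ext x
    constructor
    · intro hx
      rcases lt_or_ge x k with hxk | hxk
      · exact absurd ((shiftPerm_apply_of_lt g hxk).trans (shiftPerm_apply_of_lt h hxk).symm) hx
      · obtain ⟨x, rfl⟩ := Nat.exists_eq_add_of_le' hxk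
        rw [Set.mem_ofPred_eq, shiftPerm_apply_add, shiftPerm_apply_add] at hx
        exact ⟨x, fun hgh => hx (congrArg (· + k) hgh), rfl⟩
    · rintro ⟨x, hx, rfl⟩
      rw [Set.mem_ofPred_eq, shiftPerm_apply_add, shiftPerm_apply_add]
      exact (add_left_injective k).ne hx
  rw [disagreement, himage, (add_left_injective k).encard_image, disagreement]

theorem permDist_phi_le {n : ℕ} {p q : Path} (hp : Decomposed n p) (hq : Decomposed n q) :
    (permDist (phi n p) (phi n q) : ℕ∞) ≤ disagreement (pathPerm n p) (pathPerm n q) := by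
  rw [permDist, hammingDist, ← Set.encard_coe_eq_coe_finsetCard,
    ← Fin.val_injective.encard_image]
  refine Set.encard_le_encard ?_
  rintro _ ⟨x, hx, rfl⟩ hpq
  rw [Finset.mem_coe, Finset.mem_filter] at hx
  exact hx.2 (Fin.ext (by rw [hp.phi_apply, hq.phi_apply, hpq]))

section wordDist

variable {α : Type*} [DecidableEq α]

theorem coe_wordDist (v w : List α) : (wordDist v w : ℕ∞) = {i : ℕ | v[i]? ≠ w[i]?}.encard := by
  rw [wordDist, ← Set.encard_coe_eq_coe_finsetCard]
  congr 1
  ext i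
  simp only [Finset.coe_filter, Finset.mem_range, Set.mem_ofPred_eq, and_iff_right_iff_imp]
  contrapose!
  intro hi
  rw [List.getElem?_eq_none (by omega), List.getElem?_eq_none (by omega)]

theorem wordDist_comm (v w : List α) : wordDist v w = wordDist w v := by
  simp only [wordDist, max_comm v.length, ne_comm (a := v[_]?)]

theorem wordDist_le_length {v w : List α} (h : v.length = w.length) : wordDist v w ≤ v.length := by
  refine (Finset.card_filter_le _ _).trans ?_
  rw [← h, max_self, Finset.card_range]

theorem wordDist_append_left (a v w : List α) : wordDist (a ++ v) (a ++ w) = wordDist v w := by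
  have getElem?_add : ∀ (u : List α) (i : ℕ), (a ++ u)[i + a.length]? = u[i]? := fun u i => by
    rw [List.getElem?_append_right (Nat.le_add_left _ _), Nat.add_sub_cancel]
  have himage : {i : ℕ | (a ++ v)[i]? ≠ (a ++ w)[i]?} =
      (· + a.length) '' {i : ℕ | v[i]? ≠ w[i]?} := by
    ext i
    constructor
    · intro hi
      rcases lt_or_ge i a.length with hia | hia
      · simp [List.getElem?_append_left hia] at hi
      · obtain ⟨i, rfl⟩ := Nat.exists_eq_add_of_le' hia
        rw [Set.mem_ofPred_eq, getElem?_add, getElem?_add] at hi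
        exact ⟨i, hi, rfl⟩
    · rintro ⟨i, hi, rfl⟩
      rwa [Set.mem_ofPred_eq, getElem?_add, getElem?_add]
  rw [← Nat.cast_inj (R := ℕ∞), coe_wordDist, himage, (add_left_injective _).encard_image,
    coe_wordDist]

theorem wordDist_append_right {v w : List α} (b : List α) (h : v.length = w.length) :
    wordDist (v ++ b) (w ++ b) = wordDist v w := by
  rw [← Nat.cast_inj (R := ℕ∞), coe_wordDist, coe_wordDist]
  congr 1
  ext i
  rw [Set.mem_ofPred_eq, Set.mem_ofPred_eq, List.getElem?_append, List.getElem?_append, h]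
  split_ifs with hi
  · rfl
  · rw [List.getElem?_eq_none (l := v) (by omega), List.getElem?_eq_none (l := w) (by omega)]
    simp only [ne_eq, not_true_eq_false]

end wordDist

theorem length_flatMap_expand (p : Path) : (p.flatMap Step.expand).length = totalWidth p := by
  induction p with
  | nil => rfl
  | cons s p ih =>
    rw [List.flatMap_cons, List.length_append, ih, totalWidth_cons]
    cases s <;> rfl

theorem pathDist_comm (p q : Path) : pathDist p q = pathDist q p := wordDist_comm _ _

theorem pathDist_append_left (a p q : Path) : pathDist (a ++ p) (a ++ q) = pathDist p q := by
  simp only [pathDist, List.flatMap_append, wordDist_append_left]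

theorem pathDist_append_right {p q : Path} (b : Path) (h : totalWidth p = totalWidth q) :
    pathDist (p ++ b) (q ++ b) = pathDist p q := by
  simp only [pathDist, List.flatMap_append]
  exact wordDist_append_right _ (by rw [length_flatMap_expand, length_flatMap_expand, h])

theorem pathDist_le_totalWidth {p q : Path} (h : totalWidth p = totalWidth q) :
    pathDist p q ≤ totalWidth p := by
  rw [← length_flatMap_expand]
  exact wordDist_le_length (by rw [length_flatMap_expand, length_flatMap_expand, h])

/-! ### Close paths -/

/-- Two paths of semilength `n` that may be neighbours in the Gray code: the paths and their
permutations are at distance at most `5`. -/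
def Close (n : ℕ) (p q : Path) : Prop :=
  pathDist p q ≤ 5 ∧ disagreement (pathPerm n p) (pathPerm n q) ≤ 5

theorem Close.symm {n : ℕ} {p q : Path} (h : Close n p q) : Close n q p :=
  ⟨pathDist_comm p q ▸ h.1, disagreement_comm (pathPerm n p) _ ▸ h.2⟩

theorem Close.level {n : ℕ} {p q : Path} (hp : Decomposed n p) (hq : Decomposed n q)
    (h : Close n p q) : Close (n + 1) (Step.e :: p) (Step.e :: q) := by
  refine ⟨(pathDist_append_left [Step.e] p q).trans_le h.1, ?_⟩
  rw [pathPerm_level hp, pathPerm_level hq, disagreement_shiftPerm]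
  exact h.2

theorem Close.arch_left {i m : ℕ} {p p' q : Path} (hp : Decomposed i p) (hp' : Decomposed i p')
    (hq : Decomposed m q) (h : Close i p p') :
    Close (i + m + 1) (archPath p q) (archPath p' q) := by
  constructor
  · have hwidth : totalWidth p = totalWidth p' := hp.totalWidth_eq.trans hp'.totalWidth_eq.symm
    exact ((pathDist_append_left [Step.u] _ _).trans (pathDist_append_right _ hwidth)).trans_le h.1
  · rw [pathPerm_arch hp hq, pathPerm_arch hp' hq, archPerm, archPerm, disagreement_mul_left]
    exact h.2

theorem Close.arch_right {i m : ℕ} {p q q' : Path} (hp : Decomposed i p) (hq : Decomposed m q)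
    (hq' : Decomposed m q') (h : Close m q q') :
    Close (i + m + 1) (archPath p q) (archPath p q') := by
  constructor
  · refine le_of_eq_of_le ?_ h.1
    simpa [archPath] using pathDist_append_left (Step.u :: (p ++ [Step.d])) q q'
  · rw [pathPerm_arch hp hq, pathPerm_arch hp hq', archPerm, archPerm, disagreement_mul_right,
      disagreement_mul_right, disagreement_shiftPerm]
    exact h.2

theorem close_level_arch {n : ℕ} {p : Path} (hp : Decomposed n p) :
    Close (n + 1) (Step.e :: p) (archPath [] p) := by
  constructor
  · have hwidth : totalWidth [Step.e] = totalWidth [Step.u, Step.d] := rfl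
    have hle := pathDist_le_totalWidth hwidth
    exact ((pathDist_append_right p hwidth).trans_le hle).trans (by decide)
  · have harch := pathPerm_arch Decomposed.nil hp
    rw [zero_add, pathPerm_nil, zero_add, archPerm, mul_one] at harch
    rw [harch, pathPerm_level hp]
    nth_rw 1 [← mul_one (shiftPerm 1 (pathPerm n p))]
    rw [disagreement_mul_left]
    refine (disagreement_le_card (s := {0, 1}) fun x hx => ?_).trans (by decide)
    simp only [Finset.mem_insert, Finset.mem_singleton] at hx
    rw [Equiv.Perm.one_apply, initialCycle_apply, if_neg (by omega), if_neg (by omega)]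

/-! ### First and last paths -/

/-- The path `eⁿ`, which is the first entry of `𝒮ₙ`. -/
def flatPath (n : ℕ) : Path := List.replicate n Step.e

/-- The last entry of `𝒮ₙ`: the path `u eⁿ⁻¹ d`, and the empty path for `n = 0`. -/
def peakPath : ℕ → Path
  | 0 => []
  | n + 1 => archPath (flatPath n) []

/-- The first entry of the list `𝒮ₙ^j`, which is `𝒮ₙ` or its reverse according to the parity
of `j`. -/
def endPath (j n : ℕ) : Path := if Odd j then flatPath n else peakPath n

theorem flatPath_succ (n : ℕ) : flatPath (n + 1) = Step.e :: flatPath n := rfl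

theorem flatPath_succ' (n : ℕ) : flatPath (n + 1) = flatPath n ++ [Step.e] :=
  List.replicate_succ'

theorem endPath_of_odd {j : ℕ} (hj : Odd j) (n : ℕ) : endPath j n = flatPath n := if_pos hj

theorem endPath_of_not_odd {j : ℕ} (hj : ¬Odd j) (n : ℕ) : endPath j n = peakPath n := if_neg hj

theorem endPath_zero (j : ℕ) : endPath j 0 = [] := by
  rw [endPath]
  split_ifs <;> rfl

theorem decomposed_flatPath : ∀ n, Decomposed n (flatPath n)
  | 0 => .nil
  | n + 1 => (decomposed_flatPath n).level

theorem decomposed_peakPath : ∀ n, Decomposed n (peakPath n)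
  | 0 => .nil
  | n + 1 => (decomposed_flatPath n).arch .nil

theorem decomposed_endPath (j n : ℕ) : Decomposed n (endPath j n) := by
  rw [endPath]
  split_ifs
  exacts [decomposed_flatPath n, decomposed_peakPath n]

theorem pathPerm_flatPath (n : ℕ) : pathPerm n (flatPath n) = 1 := by
  induction n with
  | zero => exact pathPerm_nil
  | succ n ih => rw [flatPath_succ, pathPerm_level (decomposed_flatPath n), ih, map_one]

theorem pathPerm_peakPath (n : ℕ) : pathPerm n (peakPath n) = initialCycle n := by
  cases n with
  | zero => exact pathPerm_nil
  | succ n =>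
    have harch := pathPerm_arch (decomposed_flatPath n) .nil
    rw [add_zero] at harch
    rw [peakPath, harch, pathPerm_flatPath, pathPerm_nil, archPerm, map_one, one_mul, mul_one]

theorem pathPerm_endPath_apply (j n x : ℕ) : pathPerm n (endPath j n) x =
    if Odd j then x else if x < n then x + 1 else if x = n then 0 else x := by
  by_cases hj : Odd j
  · rw [endPath_of_odd hj, pathPerm_flatPath, if_pos hj, Equiv.Perm.one_apply]
  · rw [endPath_of_not_odd hj, pathPerm_peakPath, if_neg hj, initialCycle_apply]

theorem exists_common_prefix_endPath (j i : ℕ) : ∃ a v v' : Path,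
    endPath j i = a ++ v ∧ endPath j (i + 1) = a ++ v' ∧
      totalWidth v ≤ 1 ∧ totalWidth v' = totalWidth v + 2 := by
  by_cases hj : Odd j
  · rw [endPath_of_odd hj, endPath_of_odd hj]
    exact ⟨flatPath i, [], [.e], (List.append_nil _).symm, flatPath_succ' i, zero_le_one, rfl⟩
  · rw [endPath_of_not_odd hj, endPath_of_not_odd hj]
    cases i with
    | zero => exact ⟨[], [], [.u, .d], rfl, rfl, zero_le_one, rfl⟩
    | succ i =>
      refine ⟨.u :: flatPath i, [.d], [.e, .d], rfl, ?_, le_rfl, rfl⟩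
      rw [peakPath, archPath, flatPath_succ', List.append_assoc]
      rfl

theorem exists_common_suffix_endPath (l m : ℕ) : ∃ w w' b : Path,
    endPath l (m + 1) = w ++ b ∧ endPath l m = w' ++ b ∧
      totalWidth w' ≤ 1 ∧ totalWidth w = totalWidth w' + 2 := by
  by_cases hl : Odd l
  · rw [endPath_of_odd hl, endPath_of_odd hl]
    exact ⟨[.e], [], flatPath m, rfl, rfl, zero_le_one, rfl⟩
  · rw [endPath_of_not_odd hl, endPath_of_not_odd hl]
    cases m with
    | zero => exact ⟨[.u, .d], [], [], rfl, rfl, zero_le_one, rfl⟩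
    | succ m => exact ⟨[.u, .e], [.u], flatPath m ++ [.d], rfl, rfl, le_rfl, rfl⟩

theorem pathDist_archPath_endPath_succ (j l i m : ℕ) :
    pathDist (archPath (endPath j i) (endPath l (m + 1)))
      (archPath (endPath j (i + 1)) (endPath l m)) ≤ 5 := by
  obtain ⟨a, v, v', hi, hi', hv, hv'⟩ := exists_common_prefix_endPath j i
  obtain ⟨w, w', b, hm, hm', hw', hw⟩ := exists_common_suffix_endPath l m
  have hsplit : ∀ x y : Path,
      archPath (a ++ x) (y ++ b) = (Step.u :: a) ++ ((x ++ Step.d :: y) ++ b) := fun x y => by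
    simp only [archPath, List.append_assoc, List.cons_append]
  have hwidth : ∀ x y : Path,
      totalWidth (x ++ Step.d :: y) = totalWidth x + (1 + totalWidth y) := fun x y => by
    rw [totalWidth_append, totalWidth_cons]
    rfl
  have hmiddle : totalWidth (v ++ Step.d :: w) = totalWidth (v' ++ Step.d :: w') := by
    rw [hwidth, hwidth]
    omega
  rw [hi, hi', hm, hm', hsplit, hsplit, pathDist_append_left, pathDist_append_right b hmiddle]
  refine (pathDist_le_totalWidth hmiddle).trans ?_
  rw [hwidth]
  omega

theorem disagreement_archPath_endPath_succ (j l i m : ℕ) :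
    disagreement (pathPerm (i + m + 2) (archPath (endPath j i) (endPath l (m + 1))))
      (pathPerm (i + m + 2) (archPath (endPath j (i + 1)) (endPath l m))) ≤ 5 := by
  have hleft := pathPerm_arch (decomposed_endPath j i) (decomposed_endPath l (m + 1))
  have hright := pathPerm_arch (decomposed_endPath j (i + 1)) (decomposed_endPath l m)
  rw [show i + 1 + m + 1 = i + m + 2 by omega] at hright
  rw [show i + m + 2 = i + (m + 1) + 1 by omega] at hright ⊢
  rw [hleft, hright]
  refine (disagreement_le_card (s := {i - 1, i, i + 1, i + 2, i + m + 2}) fun x hx => ?_).trans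
    (Nat.cast_le.2 Finset.card_le_five)
  simp only [Finset.mem_insert, Finset.mem_singleton] at hx
  rcases lt_or_ge x i with hxi | hxi
  · have hle := pathPerm_endPath_apply j i x
    have hle' := pathPerm_endPath_apply j (i + 1) x
    rw [archPerm_apply_of_lt, archPerm_apply_of_lt] <;> split_ifs at hle hle' <;> omega
  · obtain ⟨y, rfl⟩ : ∃ y, x = y + 1 + (i + 1 + 1) := ⟨x - (i + 3), by omega⟩
    rw [archPerm_apply_add (decomposed_endPath j (i + 1)).fixesAbove y.succ_pos,
      show y + 1 + (i + 1 + 1) = y + 2 + (i + 1) by omega,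
      archPerm_apply_add (decomposed_endPath j i).fixesAbove (by omega),
      pathPerm_endPath_apply, pathPerm_endPath_apply]
    split_ifs <;> omega

theorem close_archPath_endPath_succ (j l i m : ℕ) :
    Close (i + m + 2) (archPath (endPath j i) (endPath l (m + 1)))
      (archPath (endPath j (i + 1)) (endPath l m)) :=
  ⟨pathDist_archPath_endPath_succ j l i m, disagreement_archPath_endPath_succ j l i m⟩

/-! ### Lists -/

section orient

variable {α : Type*} {j : ℕ} {L : List α}

theorem orient_of_odd (hj : Odd j) : orient j L = L := if_pos hj

theorem orient_of_not_odd (hj : ¬Odd j) : orient j L = L.reverse := if_neg hj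

theorem mem_orient {x : α} : x ∈ orient j L ↔ x ∈ L := by
  rw [orient]
  split_ifs
  exacts [Iff.rfl, List.mem_reverse]

theorem length_orient : (orient j L).length = L.length := by
  rw [orient]
  split_ifs
  exacts [rfl, List.length_reverse]

theorem nodup_orient (h : L.Nodup) : (orient j L).Nodup := by
  rw [orient]
  split_ifs
  exacts [h, List.nodup_reverse.2 h]

theorem isChain_orient {R : α → α → Prop} (hR : ∀ a b, R a b → R b a) (h : L.IsChain R) :
    (orient j L).IsChain R := by
  rw [orient]
  split_ifs
  exacts [h, List.isChain_reverse.2 (h.imp hR)]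

end orient

section flatMap

variable {α β : Type*} {l : List α} {f : α → List β}

theorem head?_flatMap_of_head? {a : α} {b : β} (hl : l.head? = some a)
    (hf : (f a).head? = some b) : (l.flatMap f).head? = some b := by
  obtain ⟨t, rfl⟩ := List.head?_eq_some_iff.1 hl
  rw [List.flatMap_cons, List.head?_append, hf, Option.some_or]

theorem getLast?_flatMap_of_getLast? {a : α} {b : β} (hl : l.getLast? = some a)
    (hf : (f a).getLast? = some b) : (l.flatMap f).getLast? = some b := by
  obtain ⟨t, rfl⟩ := List.getLast?_eq_some_iff.1 hl
  rw [List.flatMap_append, List.flatMap_singleton, List.getLast?_append, hf, Option.some_or]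

theorem isChain_flatMap {R : β → β → Prop} (hne : ∀ a ∈ l, f a ≠ [])
    (hf : ∀ a ∈ l, (f a).IsChain R)
    (hl : l.IsChain fun a b => ∀ x ∈ (f a).getLast?, ∀ y ∈ (f b).head?, R x y) :
    (l.flatMap f).IsChain R := by
  rw [List.flatMap, List.isChain_flatten]
  · exact ⟨List.forall_mem_map.2 hf, (List.isChain_map f).2 hl⟩
  · exact fun h => let ⟨a, ha, hnil⟩ := List.mem_map.1 h; hne a ha hnil

end flatMap

section zipIdx

variable {α : Type*} {l : List α} (k : ℕ)

theorem isChain_zipIdx {R : α → α → Prop} (h : l.IsChain R) :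
    (l.zipIdx k).IsChain fun x y => R x.1 y.1 ∧ y.2 = x.2 + 1 := by
  rw [List.isChain_iff_getElem] at h ⊢
  intro i hi
  rw [List.length_zipIdx] at hi
  rw [List.getElem_zipIdx, List.getElem_zipIdx]
  exact ⟨h i hi, (add_assoc _ _ _).symm⟩

theorem pairwise_zipIdx_fst_ne (h : l.Nodup) : (l.zipIdx k).Pairwise fun x y => x.1 ≠ y.1 :=
  List.pairwise_map.1 <| show ((l.zipIdx k).map Prod.fst).Nodup by rwa [List.zipIdx_map_fst]

theorem exists_mk_mem_zipIdx {a : α} (h : a ∈ l) : ∃ j, (a, j) ∈ l.zipIdx k := by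
  rw [← List.zipIdx_map_fst k l] at h
  obtain ⟨⟨a, j⟩, hj, rfl⟩ := List.mem_map.1 h
  exact ⟨j, hj⟩

end zipIdx

/-! ### Blocks of the list of paths -/

/-- The sublist of `𝒮_{i+m+1}` formed by the paths `u p d q` with a fixed path `p` of
semilength `i`, where `aj` consists of `p` and its position in the oriented list `𝒮ᵢ`. -/
def innerBlock (i m : ℕ) (aj : Path × ℕ) : List Path :=
  (orient (aj.2 + B (i + 1) + 1) (pathList m)).map (archPath aj.1)

/-- The sublist of `𝒮_{i+m+1}` formed by the paths `u p d q` with `p` of semilength `i`. -/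
def block (i m : ℕ) : List Path :=
  ((orient (2 * i + m + 2) (pathList i)).zipIdx 1).flatMap (innerBlock i m)

theorem pathList_zero : pathList 0 = [[]] := by rw [pathList]

theorem pathList_succ (n : ℕ) :
    pathList (n + 1) = (pathList n).map (Step.e :: ·) ++
      (List.range (n + 1)).flatMap fun i => block i (n - i) := by
  rw [pathList, ← List.map_coe_finRange_eq_range, List.flatMap_map]
  congr 2
  funext i
  rw [block, show 2 * i.val + (n - i) + 2 = n + 1 + (i.val + 1) by omega]
  rfl

theorem mem_innerBlock {i m : ℕ} {aj : Path × ℕ} {p : Path} :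
    p ∈ innerBlock i m aj ↔ ∃ b ∈ pathList m, archPath aj.1 b = p := by
  simp only [innerBlock, List.mem_map, mem_orient]

theorem mem_block {i m : ℕ} {p : Path} :
    p ∈ block i m ↔ ∃ a ∈ pathList i, ∃ b ∈ pathList m, archPath a b = p := by
  simp only [block, List.mem_flatMap, mem_innerBlock]
  constructor
  · rintro ⟨aj, haj, hb⟩
    exact ⟨aj.1, mem_orient.1 (List.fst_mem_of_mem_zipIdx haj), hb⟩
  · rintro ⟨a, ha, hb⟩
    obtain ⟨j, hj⟩ := exists_mk_mem_zipIdx 1 (mem_orient.2 ha)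
    exact ⟨(a, j), hj, hb⟩

theorem mem_pathList {n : ℕ} {p : Path} : p ∈ pathList n ↔ Decomposed n p := by
  induction n using Nat.strong_induction_on generalizing p with
  | _ n ih =>
    cases n with
    | zero => rw [pathList_zero, List.mem_singleton, decomposed_zero_iff]
    | succ n =>
      simp only [pathList_succ, List.mem_append, List.mem_map, List.mem_flatMap, List.mem_range,
        mem_block, decomposed_succ_iff]
      refine or_congr ?_ ⟨?_, ?_⟩
      · exact exists_congr fun q => and_congr (ih n (by omega)) eq_comm
      · rintro ⟨i, hi, a, ha, b, hb, rfl⟩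
        exact ⟨i, n - i, a, b, by omega, (ih i hi).1 ha, (ih (n - i) (by omega)).1 hb, rfl⟩
      · rintro ⟨i, m, a, b, rfl, ha, hb, rfl⟩
        refine ⟨i, by omega, a, (ih i (by omega)).2 ha, b, ?_, rfl⟩
        rw [Nat.add_sub_cancel_left]
        exact (ih m (by omega)).2 hb

/-! ### Repetitions and length -/

theorem archPath_right_injective (p : Path) : Function.Injective (archPath p) := fun _ _ h =>
  (List.cons.inj (List.append_cancel_left (List.cons.inj h).2)).2

theorem nodup_innerBlock {i m : ℕ} {aj : Path × ℕ} (h : (pathList m).Nodup) :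
    (innerBlock i m aj).Nodup :=
  (nodup_orient h).map (archPath_right_injective aj.1)

theorem nodup_block {i m : ℕ} (hi : (pathList i).Nodup) (hm : (pathList m).Nodup) :
    (block i m).Nodup := by
  refine List.nodup_flatMap.2 ⟨fun aj _ => nodup_innerBlock hm,
    (pairwise_zipIdx_fst_ne 1 (nodup_orient hi)).imp_of_mem fun {x y} hx hy hxy => ?_⟩
  rw [Function.onFun, List.disjoint_left]
  intro p hp hp'
  obtain ⟨b, -, rfl⟩ := mem_innerBlock.1 hp
  obtain ⟨b', -, heq⟩ := mem_innerBlock.1 hp'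
  have hdec := mem_pathList.1 (mem_orient.1 (List.fst_mem_of_mem_zipIdx hx))
  have hdec' := mem_pathList.1 (mem_orient.1 (List.fst_mem_of_mem_zipIdx hy))
  exact hxy ((hdec.archPath_inj hdec').1 heq.symm).1

theorem disjoint_block {i i' m m' : ℕ} (hii : i ≠ i') : (block i m).Disjoint (block i' m') := by
  intro p hp hp'
  obtain ⟨a, ha, b, -, rfl⟩ := mem_block.1 hp
  obtain ⟨a', ha', b', -, heq⟩ := mem_block.1 hp'
  rw [mem_pathList] at ha ha'
  obtain ⟨rfl, -⟩ := (ha.archPath_inj ha').1 heq.symm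
  exact hii (ha.unique ha')

theorem disjoint_level_block {L : List Path} {i m : ℕ} :
    (L.map (Step.e :: ·)).Disjoint (block i m) := by
  intro p hp hp'
  obtain ⟨q, -, rfl⟩ := List.mem_map.1 hp
  obtain ⟨a, -, b, -, heq⟩ := mem_block.1 hp'
  exact absurd (List.cons.inj heq).1 (by decide)

theorem nodup_pathList (n : ℕ) : (pathList n).Nodup := by
  induction n using Nat.strong_induction_on with
  | _ n ih =>
    cases n with
    | zero => exact pathList_zero ▸ List.nodup_singleton _
    | succ n =>
      rw [pathList_succ, List.nodup_append', List.nodup_flatMap]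
      refine ⟨(ih n (by omega)).map List.cons_injective, ⟨fun i hi => ?_, ?_⟩,
        fun p hp hp' => ?_⟩
      · exact nodup_block (ih i (List.mem_range.1 hi)) (ih (n - i) (by omega))
      · exact List.nodup_range.imp disjoint_block
      · obtain ⟨i, -, hi⟩ := List.mem_flatMap.1 hp'
        exact disjoint_level_block hp hi

theorem length_block (i m : ℕ) :
    (block i m).length = (pathList i).length * (pathList m).length := by
  have hinner : ∀ aj, (innerBlock i m aj).length = (pathList m).length := fun aj => by
    rw [innerBlock, List.length_map, length_orient]
  rw [block, List.length_flatMap, funext hinner, List.map_const', List.sum_replicate,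
    List.length_zipIdx, length_orient, smul_eq_mul]

theorem length_pathList (n : ℕ) : (pathList n).length = Nat.largeSchroder n := by
  induction n using Nat.strong_induction_on with
  | _ n ih =>
    cases n with
    | zero => rw [pathList_zero, List.length_singleton, Nat.largeSchroder]
    | succ n =>
      have hblock : ∀ i ∈ List.range (n + 1), (block i (n - i)).length =
          Nat.largeSchroder i * Nat.largeSchroder (n - i) := fun i hi => by
        rw [length_block, ih i (List.mem_range.1 hi), ih (n - i) (by omega)]
      rw [pathList_succ, List.length_append, List.length_map, ih n (by omega),
        List.length_flatMap, List.map_congr_left hblock, Nat.largeSchroder,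
        Fin.sum_univ_eq_sum_range fun i => Nat.largeSchroder i * Nat.largeSchroder (n - i)]
      rfl

/-! ### Ends of the lists -/

theorem head?_pathList (n : ℕ) : (pathList n).head? = some (flatPath n) := by
  induction n with
  | zero =>
    rw [pathList_zero]
    rfl
  | succ n ih =>
    rw [pathList_succ, List.head?_append, List.head?_map, ih]
    rfl

theorem block_zero_right (i : ℕ) : block i 0 = (pathList i).reverse.map (archPath · []) := by
  have hinner : innerBlock i 0 = fun aj => [archPath aj.1 []] := by
    funext aj
    rw [innerBlock, pathList_zero, orient]
    split_ifs <;> rfl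
  have hodd : ¬Odd (2 * i + 0 + 2) := Nat.not_odd_iff_even.2 ⟨i + 1, by omega⟩
  rw [block, hinner, ← List.map_eq_flatMap, orient_of_not_odd hodd]
  nth_rw 2 [← List.zipIdx_map_fst 1 (pathList i).reverse]
  rw [List.map_map]
  rfl

theorem getLast?_pathList (n : ℕ) : (pathList n).getLast? = some (peakPath n) := by
  cases n with
  | zero =>
    rw [pathList_zero]
    rfl
  | succ n =>
    have hlast : (List.range (n + 1)).getLast? = some n := by
      rw [List.range_succ, List.getLast?_concat]
    have hblock : (block n (n - n)).getLast? = some (peakPath (n + 1)) := by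
      rw [Nat.sub_self, block_zero_right, List.getLast?_map, List.getLast?_reverse, head?_pathList]
      rfl
    rw [pathList_succ, List.getLast?_append, getLast?_flatMap_of_getLast? hlast hblock,
      Option.some_or]

theorem head?_orient_pathList (j n : ℕ) :
    (orient j (pathList n)).head? = some (endPath j n) := by
  by_cases hj : Odd j
  · rw [orient_of_odd hj, endPath_of_odd hj, head?_pathList]
  · rw [orient_of_not_odd hj, endPath_of_not_odd hj, List.head?_reverse, getLast?_pathList]

theorem getLast?_orient_pathList (j n : ℕ) :
    (orient j (pathList n)).getLast? = some (endPath (j + 1) n) := by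
  by_cases hj : Odd j
  · rw [orient_of_odd hj, endPath_of_not_odd fun hj' => Nat.odd_add_one.1 hj' hj,
      getLast?_pathList]
  · rw [orient_of_not_odd hj, endPath_of_odd (Nat.odd_add_one.2 hj), List.getLast?_reverse,
      head?_pathList]

theorem head?_innerBlock (i m : ℕ) (aj : Path × ℕ) :
    (innerBlock i m aj).head? = some (archPath aj.1 (endPath (aj.2 + B (i + 1) + 1) m)) := by
  rw [innerBlock, List.head?_map, head?_orient_pathList, Option.map_some]

theorem getLast?_innerBlock (i m : ℕ) (aj : Path × ℕ) :
    (innerBlock i m aj).getLast? = some (archPath aj.1 (endPath (aj.2 + B (i + 1) + 2) m)) := by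
  rw [innerBlock, List.getLast?_map, getLast?_orient_pathList, Option.map_some]

theorem head?_block (i m : ℕ) : (block i m).head? =
    some (archPath (endPath (2 * i + m + 2) i) (endPath (B (i + 1) + 2) m)) := by
  have hhead : ((orient (2 * i + m + 2) (pathList i)).zipIdx 1).head? =
      some (endPath (2 * i + m + 2) i, 1) := by
    rw [List.head?_zipIdx, head?_orient_pathList, Option.map_some]
  rw [block, head?_flatMap_of_head? hhead (head?_innerBlock i m _),
    show 1 + B (i + 1) + 1 = B (i + 1) + 2 by omega]

theorem B_add_two (i : ℕ) : B (i + 2) = B (i + 1) + Nat.largeSchroder i :=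
  Finset.sum_range_succ _ i

theorem getLast?_block (i m : ℕ) : (block i m).getLast? =
    some (archPath (endPath (2 * i + m + 3) i) (endPath (B (i + 2) + 2) m)) := by
  have hlast : ((orient (2 * i + m + 2) (pathList i)).zipIdx 1).getLast? =
      some (endPath (2 * i + m + 3) i, Nat.largeSchroder i) := by
    rw [List.getLast?_zipIdx, getLast?_orient_pathList, length_orient, length_pathList,
      Option.map_some, Nat.add_sub_cancel_left]
  rw [block, getLast?_flatMap_of_getLast? hlast (getLast?_innerBlock i m _), B_add_two,
    Nat.add_comm (Nat.largeSchroder i)]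

/-! ### Consecutive entries -/

theorem isChain_innerBlock {i m : ℕ} {aj : Path × ℕ} (ha : Decomposed i aj.1)
    (hm : (pathList m).IsChain (Close m)) : (innerBlock i m aj).IsChain (Close (i + m + 1)) := by
  rw [innerBlock, List.isChain_map]
  refine (isChain_orient (fun _ _ => Close.symm) hm).imp_of_mem_imp fun b b' hb hb' hclose => ?_
  rw [mem_orient, mem_pathList] at hb hb'
  exact hclose.arch_right ha hb hb'

theorem isChain_block {i m : ℕ} (hi : (pathList i).IsChain (Close i))
    (hm : (pathList m).IsChain (Close m)) : (block i m).IsChain (Close (i + m + 1)) := by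
  have hdec : ∀ aj ∈ (orient (2 * i + m + 2) (pathList i)).zipIdx 1, Decomposed i aj.1 :=
    fun aj haj => mem_pathList.1 (mem_orient.1 (List.fst_mem_of_mem_zipIdx haj))
  refine isChain_flatMap (fun aj _ hnil => ?_) (fun aj haj => isChain_innerBlock (hdec aj haj) hm)
    ((isChain_zipIdx 1 (isChain_orient (fun _ _ => Close.symm) hi)).imp_of_mem_imp ?_)
  · exact absurd (hnil ▸ head?_innerBlock i m aj) (Option.some_ne_none _).symm
  · rintro aj aj' haj haj' ⟨hclose, hsucc⟩ x hx y hy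
    rw [getLast?_innerBlock, Option.mem_some_iff] at hx
    rw [head?_innerBlock, Option.mem_some_iff, hsucc,
      show aj.2 + 1 + B (i + 1) + 1 = aj.2 + B (i + 1) + 2 by omega] at hy
    subst hx hy
    exact hclose.arch_left (hdec aj haj) (hdec aj' haj') (decomposed_endPath _ m)

theorem close_block_block {i m : ℕ} {p q : Path} (hp : p ∈ (block i (m + 1)).getLast?)
    (hq : q ∈ (block (i + 1) m).head?) : Close (i + m + 2) p q := by
  rw [getLast?_block, Option.mem_some_iff] at hp
  rw [head?_block, Option.mem_some_iff,
    show 2 * (i + 1) + m + 2 = 2 * i + (m + 1) + 3 by omega] at hq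
  subst hp hq
  exact close_archPath_endPath_succ _ _ i m

theorem head?_block_zero_left (n : ℕ) : (block 0 n).head? = some (archPath [] (peakPath n)) := by
  rw [head?_block, endPath_zero, endPath_of_not_odd (by decide)]

theorem isChain_pathList (n : ℕ) : (pathList n).IsChain (Close n) := by
  induction n using Nat.strong_induction_on with
  | _ n ih =>
    cases n with
    | zero => exact pathList_zero ▸ List.isChain_singleton _
    | succ n =>
      rw [pathList_succ, List.isChain_append]
      refine ⟨?_, isChain_flatMap (fun i _ hnil => ?_) (fun i hi => ?_) ?_, ?_⟩
      · rw [List.isChain_map]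
        exact (ih n (by omega)).imp_of_mem_imp fun p q hp hq hclose =>
          hclose.level (mem_pathList.1 hp) (mem_pathList.1 hq)
      · exact absurd (hnil ▸ head?_block i (n - i)) (Option.some_ne_none _).symm
      · have hle : i ≤ n := Nat.lt_succ_iff.1 (List.mem_range.1 hi)
        have hchain := isChain_block (ih i (by omega)) (ih (n - i) (by omega))
        rwa [Nat.add_sub_of_le hle] at hchain
      · refine (List.isChain_range_succ _ n).2 fun i hi p hp q hq => ?_
        obtain ⟨m, rfl⟩ : ∃ m, n = i + m + 1 := ⟨n - i - 1, by omega⟩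
        rw [show i + m + 1 - i = m + 1 by omega] at hp
        rw [show i + m + 1 - i.succ = m by omega] at hq
        exact close_block_block hp hq
      · have hhead : (List.range (n + 1)).head? = some 0 := by
          rw [List.range_succ_eq_map, List.head?_cons]
        intro p hp q hq
        rw [List.getLast?_map, getLast?_pathList, Option.map_some, Option.mem_some_iff] at hp
        rw [head?_flatMap_of_head? hhead (head?_block_zero_left n), Option.mem_some_iff] at hq
        subst hp hq
        exact close_level_arch (decomposed_peakPath n)

end SchroderGray

open SchroderGray

theorem mainTheorem3 (n : ℕ) :
    (SchroderGray.pathList n).length = Nat.largeSchroder n ∧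
    SchroderGray.IsGrayCode SchroderGray.pathDist 5
      {p | SchroderGray.IsSchroderPath n p} (SchroderGray.pathList n) ∧
    Set.BijOn (SchroderGray.phi n)
      {p | SchroderGray.IsSchroderPath n p} (SchroderGray.schroderPerms (n + 1)) ∧
    SchroderGray.IsGrayCode SchroderGray.permDist 5
      (SchroderGray.schroderPerms (n + 1)) (SchroderGray.permList n) := by
  have hmem : ∀ p, p ∈ pathList n ↔ p ∈ {p | IsSchroderPath n p} := fun p =>
    mem_pathList.trans isSchroderPath_iff_decomposed.symm
  have hclose := List.isChain_iff_getElem.1 (isChain_pathList n)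
  refine ⟨length_pathList n, ⟨nodup_pathList n, hmem, fun q hq => (hclose q hq).1⟩,
    phi_bijOn n, ?_, fun π => ?_, fun q hq => ?_⟩
  · exact (nodup_pathList n).map_on fun p hp q hq heq =>
      (phi_bijOn n).injOn ((hmem p).1 hp) ((hmem q).1 hq) heq
  · rw [permList, List.mem_map, ← (phi_bijOn n).image_eq]
    exact exists_congr fun p => and_congr_left' (hmem p)
  · simp only [permList, List.length_map] at hq
    simp only [permList, List.getElem_map]
    have hle := permDist_phi_le (mem_pathList.1 (List.getElem_mem (Nat.lt_of_succ_lt hq)))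
      (mem_pathList.1 (List.getElem_mem hq))
    exact_mod_cast hle.trans (hclose q hq).2
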